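/- Let $G$ be a second-countable locally compact (Hausdorff) unimodular group with Haar measure $\mu_G$, and let $Q\subseteq G$ be a fixed compact symmetric neighbourhood of the identity. A *Følner sequence* is a sequence $(K_n)_{n\in\mathbb N}$ of non-null compact subsets of $G$ with $\mu_G(K_nK\,\triangle\,K_n)/\mu_G(K_n)\to 0$ for every non-empty compact $K\subseteq G$; it is a *strong Følner sequence* if moreover $\mu_G(K_nK\cap K_n^cK)/\mu_G(K_n)\to 0$ for every compact $K\subseteq G$. Assume that $G$ is amenable, i.e. that it admits a Følner sequence. For a discrete set $\Lambda\subseteq G$ put $$D^-(\Lambda)=\lim_{n\to\infty}\inf_{x\in G}\frac{\#(\Lambda\cap xK_n)}{\mu_G(K_n)},\qquad D^+(\Lambda)=\lim_{n\to\infty}\sup_{x\in G}\frac{\#(\Lambda\cap xK_n)}{\mu_G(K_n)},$$ where $(K_n)$ is any strong Følner sequence. Let $(\pi,\mathcal H_\pi)$ be a projective unitary representation of $G$ on a complex Hilbert space, that is, a strongly measurable map $\pi:G\to\mathcal U(\mathcal H_\pi)$ with $\pi(xy)=\sigma(x,y)\pi(x)\pi(y)$ for some $\sigma:G\times G\to\mathbb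 T$. Write $V_gf(x)=\langle f,\pi(x)g\rangle$. Assume that $\pi$ is irreducible (the only closed invariant subspaces are $\{0\}$ and $\mathcal H_\pi$) and square-integrable ($V_gg\in L^2(G)$ for some $g\neq 0$). Its formal degree is the number $d_\pi>0$ such that, for all $f_1,f_2,g_1,g_2\in\mathcal H_\pi$, $$\int_G\langle f_1,\pi(x)g_1\rangle\langle\pi(x)g_2,f_2\rangle\,d\mu_G(x)=d_\pi^{-1}\langle f_1,f_2\rangle\overline{\langle g_1,g_2\rangle}.$$ Let $\mathcal B^2_\pi$ be the set of all $g\in\mathcal H_\pi$ such that $V_gg\in L^\infty_{\mathrm{loc}}(G)$ and the function $x\mapsto\operatorname{ess\,sup}_{z\in Q}|V_gg(xz)|$ belongs to $L^2(G)$. **Corollary.** Let $\Lambda\subseteq G$ be discrete and $g\in\mathcal B^2_\pi$, and suppose that $(\pi(\lambda)g)_{\lambda\in\Lambda}$ is a frame for $\mathcal H_\pi$ with frame bounds $A,B>0$, i.e. $$A\|f\|^2\le\sum_{\lambda\in\Lambda}|\langle f,\pi(\lambda)g\rangle|^2\le B\|f\|^2\qquad\text{for all } f\in\mathcal H_\pi.$$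 Then the formal degree $d_\pi$ exists, strong Følner sequences exist, the limits $D^-(\Lambda)$ and $D^+(\Lambda)$ exist, are finite and do not depend on the strong Følner sequence, and $$A\le d_\pi^{-1}D^-(\Lambda)\|g\|^2\le d_\pi^{-1}D^+(\Lambda)\|g\|^2\le B.$$ In particular, if $A=B$, then $D^-(\Lambda)=D^+(\Lambda)$. -/

import Mathlib

open MeasureTheory Filter Topology
open scoped Pointwise ENNReal NNReal

namespace CoherentFrame

/-! ### Følner sequences and Beurling density -/

section Density

variable {G : Type*} [Group G] [TopologicalSpace G] [MeasurableSpace G]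

/-- A (right) Følner sequence: non-null compact sets `K n` with
`μ (K n * C ∆ K n) / μ (K n) → 0` for every non-empty compact set `C`. -/
structure IsFolner (μ : Measure G) (K : ℕ → Set G) : Prop where
  isCompact : ∀ n, IsCompact (K n)
  measure_ne_zero : ∀ n, μ (K n) ≠ 0
  tendsto_symmDiff : ∀ C : Set G, IsCompact C → C.Nonempty →
    Tendsto (fun n => μ (symmDiff (K n * C) (K n)) / μ (K n)) atTop (𝓝 0)

/-- A (right) strong Følner sequence: a Følner sequence such that moreover
`μ (K n * C ∩ (K n)ᶜ * C) / μ (K n) → 0` for every compact set `C`. -/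
structure IsStrongFolner (μ : Measure G) (K : ℕ → Set G) : Prop extends IsFolner μ K where
  tendsto_boundary : ∀ C : Set G, IsCompact C →
    Tendsto (fun n => μ ((K n * C) ∩ ((K n)ᶜ * C)) / μ (K n)) atTop (𝓝 0)

/-- The group, with Haar measure `μ`, is amenable: it admits a Følner sequence. -/
def IsAmenable (μ : Measure G) : Prop := ∃ K : ℕ → Set G, IsFolner μ K

/-- `D` is the lower Beurling density of `Λ`: strong Følner sequences exist, and
`inf_x #(Λ ∩ x K n) / μ (K n)` converges to `D` along each of them. -/
def HasLowerDensity (μ : Measure G) (Λ : Set G) (D : ℝ≥0) : Prop :=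
  (∃ K : ℕ → Set G, IsStrongFolner μ K) ∧
  ∀ K : ℕ → Set G, IsStrongFolner μ K →
    Tendsto (fun n => ⨅ x : G, ((Λ ∩ x • K n).encard : ℝ≥0∞) / μ (K n)) atTop (𝓝 (D : ℝ≥0∞))

/-- `D` is the upper Beurling density of `Λ`: strong Følner sequences exist, and
`sup_x #(Λ ∩ x K n) / μ (K n)` converges to `D` along each of them. -/
def HasUpperDensity (μ : Measure G) (Λ : Set G) (D : ℝ≥0) : Prop :=
  (∃ K : ℕ → Set G, IsStrongFolner μ K) ∧
  ∀ K : ℕ → Set G, IsStrongFolner μ K →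
    Tendsto (fun n => ⨆ x : G, ((Λ ∩ x • K n).encard : ℝ≥0∞) / μ (K n)) atTop (𝓝 (D : ℝ≥0∞))

end Density

/-! ### Local maximal functions and Wiener amalgam spaces -/

section Amalgam

variable {G : Type*} [Group G] [TopologicalSpace G] [MeasurableSpace G]

/-- The left local maximal function `x ↦ ess sup_{z ∈ Q} |F (x z)|`, with values in `[0, ∞]`. -/
noncomputable def localMaximal (μ : Measure G) (Q : Set G) (F : G → ℂ) (x : G) : ℝ≥0∞ :=
  essSup (fun z => ‖F (x * z)‖ₑ) (μ.restrict Q)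

/-- Membership in `W^L(L^p)`: the function `F` lies in `L^∞_loc` and its left local maximal
function lies in `L^p`. -/
structure MemAmalgam (μ : Measure G) (Q : Set G) (p : ℝ≥0∞) (F : G → ℂ) : Prop where
  aestronglyMeasurable : AEStronglyMeasurable F μ
  locally_bounded : ∀ C : Set G, IsCompact C → essSup (fun x => ‖F x‖ₑ) (μ.restrict C) < ∞
  memLp : MemLp (localMaximal μ Q F) p μ

end Amalgam

/-! ### Projective unitary representations -/

/-- A projective unitary representation: a strongly measurable map `π` from `G` to the unitary
operators of `H` with `π (x y) = σ x y • π x ∘ π y`, where `σ` is circle-valued. -/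
structure ProjRep (G H : Type*) [Group G] [MeasurableSpace G]
    [NormedAddCommGroup H] [InnerProductSpace ℂ H] where
  /-- the operators -/
  op : G → (H ≃ₗᵢ[ℂ] H)
  /-- the cocycle -/
  σ : G → G → Circle
  map_mul : ∀ (x y : G) (f : H), op (x * y) f = (σ x y : ℂ) • op x (op y f)
  stronglyMeasurable : ∀ f : H, StronglyMeasurable (fun x => op x f)

namespace ProjRep

variable {G H : Type*} [Group G] [TopologicalSpace G] [MeasurableSpace G]
  [NormedAddCommGroup H] [InnerProductSpace ℂ H]

/-- The coefficient transform `V_g f (x) = ⟨f, π(x) g⟩`, where `⟨·, ·⟩` is linear in its first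
argument (Mathlib's `inner` is linear in its second). -/
noncomputable def coeff (π : ProjRep G H) (g f : H) (x : G) : ℂ := inner ℂ (π.op x g) f

/-- The only closed invariant subspaces are `{0}` and `H`. -/
def IsIrreducible (π : ProjRep G H) : Prop :=
  ∀ W : Submodule ℂ H, IsClosed (W : Set H) → (∀ x : G, ∀ f ∈ W, π.op x f ∈ W) →
    W = ⊥ ∨ W = ⊤

/-- A discrete series (irreducible square-integrable) representation. -/
def IsDiscreteSeries (μ : Measure G) (π : ProjRep G H) : Prop :=
  π.IsIrreducible ∧ ∃ g : H, g ≠ 0 ∧ MemLp (π.coeff g g) 2 μ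

/-- `d` is the formal degree of `π`: the positive number for which the orthogonality relations
`∫ ⟨f₁, π(x) g₁⟩ ⟨π(x) g₂, f₂⟩ dμ(x) = d⁻¹ ⟨f₁, f₂⟩ conj ⟨g₁, g₂⟩` hold (brackets linear in
the first argument). -/
def IsFormalDegree (μ : Measure G) (π : ProjRep G H) (d : ℝ) : Prop :=
  0 < d ∧ ∀ f₁ f₂ g₁ g₂ : H,
    Integrable (fun x => inner ℂ (π.op x g₁) f₁ * inner ℂ f₂ (π.op x g₂)) μ ∧
    ∫ x, inner ℂ (π.op x g₁) f₁ * inner ℂ f₂ (π.op x g₂) ∂μ =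
      (d : ℂ)⁻¹ * inner ℂ f₂ f₁ * (starRingEnd ℂ) (inner ℂ g₂ g₁)

/-- The set `B²_π` of all `g` with `V_g g ∈ W^L(L²)`. -/
def B2 (μ : Measure G) (Q : Set G) (π : ProjRep G H) : Set H :=
  {g | MemAmalgam μ Q 2 (π.coeff g g)}

/-- `(π(l) g)_{l ∈ Λ}` is a frame for `H` with frame bounds `A` and `B`. -/
structure IsFrame (π : ProjRep G H) (Λ : Set G) (g : H) (A B : ℝ) : Prop where
  lower_pos : 0 < A
  upper_pos : 0 < B
  summable : ∀ f : H, Summable (fun l : Λ => ‖π.coeff g f l‖ ^ 2)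
  lower : ∀ f : H, A * ‖f‖ ^ 2 ≤ ∑' l : Λ, ‖π.coeff g f l‖ ^ 2
  upper : ∀ f : H, ∑' l : Λ, ‖π.coeff g f l‖ ^ 2 ≤ B * ‖f‖ ^ 2

end ProjRep

end CoherentFrame

open CoherentFrame

/-!
Put `φ = |V_g g|²`. Integrating the sampling sum `y ↦ ∑_{l ∈ Λ} φ (y⁻¹ l)` over a window `x K n`
counts each point of `Λ` in the window with weight `∫ φ`, up to points near the boundary; the
boundary of a strong Følner window is negligible and, for the lower bound, the tails of `φ` are
controlled by the local maximal function of `V_g g`. Hence a bound on the sampling sums is a bound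
on density times `∫ φ`. The frame inequality for `π(y) g` bounds the sampling sum between
`A ‖g‖²` and `B ‖g‖²`, and the orthogonality relations give `∫ φ = d⁻¹ ‖g‖⁴`.

For the formal degree, Schur's lemma is applied to `(1 + V†V)⁻¹`, where `V = V_g` is the closed,
possibly unbounded coefficient transform. It is bounded and commutes with `π`, hence is a scalar,
so `V_g` is a multiple of an isometry; inversion invariance of the Haar measure then forces this
multiple to be proportional to `‖g‖²`.
-/

namespace CoherentFrame

/-! ### Strong Følner sequences -/

section Unimodular

variable {G : Type*} [Group G] [TopologicalSpace G] [IsTopologicalGroup G]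
  [LocallyCompactSpace G] [SecondCountableTopology G] [MeasurableSpace G] [BorelSpace G]

theorem isInvInvariant_of_isMulRightInvariant (μ : Measure G) [μ.IsHaarMeasure]
    [μ.IsMulRightInvariant] : μ.IsInvInvariant := by
  obtain ⟨K, hK, hK1⟩ := exists_compact_mem_nhds (1 : G)
  set L := K ∪ K⁻¹
  have hL : IsCompact L := hK.union hK.inv
  have hL_pos : μ L ≠ 0 :=
    (Measure.measure_pos_of_mem_nhds μ (mem_of_superset hK1 Set.subset_union_left)).ne'
  have h_smul : μ.inv = μ.inv.haarScalarFactor μ • μ := Measure.isMulLeftInvariant_eq_smul μ.inv μ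
  have h_factor : (μ.inv.haarScalarFactor μ : ℝ≥0∞) * μ L = 1 * μ L := by
    have hL_inv : L⁻¹ = L := by simp [L, Set.union_comm]
    simpa [hL_inv] using (congrArg (fun ν : Measure G ↦ ν L) h_smul).symm
  have h_one : μ.inv.haarScalarFactor μ = 1 :=
    mod_cast (ENNReal.mul_left_inj hL_pos hL.measure_lt_top.ne).1 h_factor
  exact ⟨by rw [h_smul, h_one, one_smul]⟩

end Unimodular

section ThickBoundary

variable {G : Type*} [Group G] {K C : Set G}

/-- The boundary of `K` of thickness `C`: the points that can be reached both from `K` and from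
its complement by a right translation by an element of `C`. -/
def thickBoundary (K C : Set G) : Set G := (K * C) ∩ (Kᶜ * C)

theorem thickBoundary_mul_subset (K C V : Set G) :
    thickBoundary K C * V ⊆ thickBoundary K (C * V) := by
  simpa only [thickBoundary, mul_assoc] using Set.inter_mul_subset (s₁ := K * C) (s₂ := Kᶜ * C)

theorem subset_sdiff_union_thickBoundary (hC : 1 ∈ C) :
    K ⊆ (K \ (Kᶜ * C)) ∪ thickBoundary K C := by
  intro x hx
  by_cases h : x ∈ Kᶜ * C
  · exact .inr ⟨Set.subset_mul_left K hC hx, h⟩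
  · exact .inl ⟨hx, h⟩

theorem mul_subset_union_thickBoundary (hC : 1 ∈ C) : K * C ⊆ K ∪ thickBoundary K C := by
  intro x hx
  by_cases h : x ∈ K
  · exact .inl h
  · exact .inr ⟨hx, Set.subset_mul_left Kᶜ hC h⟩

theorem exists_smul_inv_subset_of_mem_thickBoundary {Q : Set G} {x : G}
    (hx : x ∈ thickBoundary (K * Q) C) :
    ∃ b : G, b • Q⁻¹ ⊆ ((K * (Q * C * (Q * C)⁻¹)) \ K) ∩ x • (Q * C)⁻¹ := by
  obtain ⟨⟨_, ⟨k, hk, q, hq, rfl⟩, c, hc, rfl⟩, b, hb, c', hc', hbc⟩ := hx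
  have hb_eq : b = k * q * c * c'⁻¹ := eq_mul_inv_of_mul_eq hbc
  refine ⟨b, ?_⟩
  rintro _ ⟨p, hp, rfl⟩
  have hp_mem : c'⁻¹ * p ∈ (Q * C)⁻¹ := by
    rw [Set.mem_inv, mul_inv_rev, inv_inv]
    exact Set.mul_mem_mul hp hc'
  refine ⟨⟨⟨k, hk, q * c * (c'⁻¹ * p), Set.mul_mem_mul (Set.mul_mem_mul hq hc) hp_mem, ?_⟩,
    fun h ↦ hb ⟨b * p, h, p⁻¹, hp, by simp⟩⟩, c'⁻¹ * p, hp_mem, ?_⟩ <;>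
  simp [hb_eq, mul_assoc]

end ThickBoundary

section Folner

variable {G : Type*} [Group G] [MeasurableSpace G]

theorem mul_measure_le_of_forall_le_measure_inter_smul [MeasurableMul₂ G] [MeasurableInv G]
    {μ : Measure G} [SFinite μ] [μ.IsMulLeftInvariant] {X E D : Set G} (hX : MeasurableSet X)
    (hE : MeasurableSet E) (hD : MeasurableSet D) {c : ℝ≥0∞}
    (hc : ∀ x ∈ X, c ≤ μ (E ∩ x • D)) : c * μ X ≤ μ D⁻¹ * μ E := by
  set P : Set (G × G) := X ×ˢ E ∩ (fun p : G × G ↦ p.1⁻¹ * p.2) ⁻¹' D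
  have hP : MeasurableSet P :=
    (hX.prod hE).inter ((measurable_fst.inv.mul measurable_snd) hD)
  have h_fst : ∀ x ∈ X, c ≤ μ (Prod.mk x ⁻¹' P) := fun x hx ↦
    (hc x hx).trans (measure_mono fun y hy ↦ ⟨⟨hx, hy.1⟩, Set.mem_smul_set_iff_inv_smul_mem.1 hy.2⟩)
  have h_snd : ∀ y, μ ((fun x ↦ (x, y)) ⁻¹' P) ≤ E.indicator (fun _ ↦ μ D⁻¹) y := by
    intro y
    by_cases hy : y ∈ E
    · rw [Set.indicator_of_mem hy, ← measure_smul μ y D⁻¹]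
      refine measure_mono fun x hx ↦ ?_
      rw [Set.mem_smul_set_iff_inv_smul_mem, smul_eq_mul, Set.mem_inv, mul_inv_rev, inv_inv]
      exact hx.2
    · have : (fun x ↦ (x, y)) ⁻¹' P = ∅ := Set.eq_empty_of_forall_notMem fun x hx ↦ hy hx.1.2
      simp [this]
  calc c * μ X = ∫⁻ _ in X, c ∂μ := (setLIntegral_const X c).symm
    _ ≤ ∫⁻ x in X, μ (Prod.mk x ⁻¹' P) ∂μ := setLIntegral_mono' hX h_fst
    _ ≤ ∫⁻ x, μ (Prod.mk x ⁻¹' P) ∂μ := setLIntegral_le_lintegral _ _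
    _ = ∫⁻ y, μ ((fun x ↦ (x, y)) ⁻¹' P) ∂μ := by
      rw [← Measure.prod_apply hP, Measure.prod_apply_symm hP]
    _ ≤ ∫⁻ y, E.indicator (fun _ ↦ μ D⁻¹) y ∂μ := lintegral_mono h_snd
    _ = μ D⁻¹ * μ E := lintegral_indicator_const hE _

variable [TopologicalSpace G] [IsTopologicalGroup G] {μ : Measure G}

theorem IsFolner.mul_right {K : ℕ → Set G} (hK : IsFolner μ K) {Q : Set G} (hQ : IsCompact Q)
    (h1Q : 1 ∈ Q) : IsFolner μ (fun n ↦ K n * Q) where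
  isCompact n := (hK.isCompact n).mul hQ
  measure_ne_zero n h :=
    hK.measure_ne_zero n (measure_mono_null (Set.subset_mul_left _ h1Q) h)
  tendsto_symmDiff C hC hC_ne := by
    have h_lim := (hK.tendsto_symmDiff (Q * C) (hQ.mul hC) (.mul ⟨1, h1Q⟩ hC_ne)).add
      (hK.tendsto_symmDiff Q hQ ⟨1, h1Q⟩)
    rw [add_zero] at h_lim
    refine tendsto_of_tendsto_of_tendsto_of_le_of_le tendsto_const_nhds h_lim
      (fun _ ↦ zero_le) fun n ↦ ?_
    dsimp only
    rw [← ENNReal.add_div, mul_assoc, symmDiff_comm (K n * Q) (K n)]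
    refine ENNReal.div_le_div ?_ (measure_mono (Set.subset_mul_left _ h1Q))
    exact (measure_mono (symmDiff_triangle _ (K n) _)).trans (measure_union_le _ _)

variable [T2Space G] [LocallyCompactSpace G] [SecondCountableTopology G] [BorelSpace G]
  [μ.IsHaarMeasure]

theorem measure_thickBoundary_mul_le {K Q C : Set G} (hK : IsCompact K) (hQ : IsCompact Q)
    (hC : IsCompact C) :
    μ Q⁻¹ * μ (thickBoundary (K * Q) C) ≤ μ (Q * C) * μ ((K * (Q * C * (Q * C)⁻¹)) \ K) := by
  have hX : MeasurableSet (thickBoundary (K * Q) C) := ((hK.mul hQ).mul hC).measurableSet.inter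
    ((hK.mul hQ).isClosed.isOpen_compl.mul_right).measurableSet
  have hM : IsCompact (Q * C) := hQ.mul hC
  have h_section : ∀ x ∈ thickBoundary (K * Q) C,
      μ Q⁻¹ ≤ μ ((K * (Q * C * (Q * C)⁻¹)) \ K ∩ x • (Q * C)⁻¹) := by
    intro x hx
    obtain ⟨b, hb⟩ := exists_smul_inv_subset_of_mem_thickBoundary hx
    simpa only [measure_smul] using measure_mono (μ := μ) hb
  simpa only [inv_inv] using mul_measure_le_of_forall_le_measure_inter_smul hX
    ((hK.mul (hM.mul hM.inv)).measurableSet.diff hK.measurableSet) hM.inv.measurableSet h_section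

theorem IsFolner.isStrongFolner_mul {K : ℕ → Set G} (hK : IsFolner μ K)
    {Q : Set G} (hQ : IsCompact Q) (hQ_nhds : Q ∈ 𝓝 (1 : G)) :
    IsStrongFolner μ (fun n ↦ K n * Q) where
  toIsFolner := hK.mul_right hQ (mem_of_mem_nhds hQ_nhds)
  tendsto_boundary C hC := by
    rcases C.eq_empty_or_nonempty with rfl | hC_ne
    · simp
    have h1Q : (1 : G) ∈ Q := mem_of_mem_nhds hQ_nhds
    have hM : IsCompact (Q * C) := hQ.mul hC
    have hM_ne : (Q * C).Nonempty := .mul ⟨1, h1Q⟩ hC_ne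
    have hQ_pos : μ Q⁻¹ ≠ 0 :=
      (Measure.measure_pos_of_mem_nhds μ (inv_mem_nhds_one G hQ_nhds)).ne'
    have hc : μ (Q * C) / μ Q⁻¹ ≠ ∞ := ENNReal.div_ne_top hM.measure_lt_top.ne hQ_pos
    have h_lim := ENNReal.Tendsto.const_mul
      (hK.tendsto_symmDiff _ (hM.mul hM.inv) (hM_ne.mul hM_ne.inv)) (.inr hc)
    rw [mul_zero] at h_lim
    refine tendsto_of_tendsto_of_tendsto_of_le_of_le tendsto_const_nhds h_lim
      (fun _ ↦ zero_le) fun n ↦ ?_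
    dsimp only
    rw [← mul_div_assoc, ← ENNReal.mul_div_right_comm]
    refine ENNReal.div_le_div ?_ (measure_mono (Set.subset_mul_left _ h1Q))
    rw [ENNReal.le_div_iff_mul_le (.inl hQ_pos) (.inl hQ.inv.measure_lt_top.ne), mul_comm]
    refine (measure_thickBoundary_mul_le (hK.isCompact n) hQ hC).trans ?_
    gcongr
    exact Set.subset_union_left

end Folner

/-! ### Relatively separated sets and their densities -/

section Counting

variable {α : Type*} {Λ S T U : Set α}

theorem encard_inter_eq_tsum (Λ S : Set α) :
    ((Λ ∩ S).encard : ℝ≥0∞) = ∑' l : Λ, S.indicator 1 (l : α) := by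
  rw [← ENNReal.tsum_set_one, tsum_subtype (Λ ∩ S) (fun _ ↦ (1 : ℝ≥0∞)),
    tsum_subtype Λ (S.indicator (1 : α → ℝ≥0∞))]
  simp_rw [← Set.indicator_indicator]
  rfl

theorem encard_inter_mono (h : S ⊆ T) : ((Λ ∩ S).encard : ℝ≥0∞) ≤ (Λ ∩ T).encard :=
  mod_cast Set.encard_le_encard (Set.inter_subset_inter_right Λ h)

theorem encard_inter_le_add (h : S ⊆ T ∪ U) :
    ((Λ ∩ S).encard : ℝ≥0∞) ≤ (Λ ∩ T).encard + (Λ ∩ U).encard := by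
  refine (encard_inter_mono h).trans ?_
  rw [Set.inter_union_distrib_left]
  exact_mod_cast Set.encard_union_le _ _

theorem tsum_indicator_inv_mul {G : Type*} [Group G] (Λ C : Set G) (y : G) :
    ∑' l : Λ, C.indicator (1 : G → ℝ≥0∞) (y⁻¹ * l) = (Λ ∩ y • C).encard := by
  rw [encard_inter_eq_tsum, ← Set.preimage_smul_inv]
  rfl

end Counting

section RelativelySeparated

variable {G : Type*} [Group G] [TopologicalSpace G]

/-- A set is relatively separated if the number of its points in a translate of some fixed open
neighbourhood of the identity is uniformly bounded. -/
def IsRelativelySeparated (Λ : Set G) : Prop :=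
  ∃ O : Set G, IsOpen O ∧ 1 ∈ O ∧ ∃ R : ℝ≥0, ∀ x : G, ((Λ ∩ x • O).encard : ℝ≥0∞) ≤ R

namespace IsRelativelySeparated

variable {Λ V : Set G}

theorem exists_subset (hΛ : IsRelativelySeparated Λ) (hV : V ∈ 𝓝 1) :
    ∃ O : Set G, IsOpen O ∧ 1 ∈ O ∧ O ⊆ V ∧
      ∃ R : ℝ≥0, ∀ x : G, ((Λ ∩ x • O).encard : ℝ≥0∞) ≤ R := by
  obtain ⟨O, hO, h1O, R, hR⟩ := hΛ
  exact ⟨O ∩ interior V, hO.inter isOpen_interior, ⟨h1O, mem_interior_iff_mem_nhds.2 hV⟩,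
    Set.inter_subset_right.trans interior_subset, R,
    fun x ↦ (encard_inter_mono (Set.smul_set_mono Set.inter_subset_left)).trans (hR x)⟩

protected theorem countable [IsTopologicalGroup G] [SecondCountableTopology G]
    (hΛ : IsRelativelySeparated Λ) : Λ.Countable := by
  obtain ⟨O, hO, h1O, R, hR⟩ := hΛ
  have h_nhds : ∀ x : G, x • O ∈ 𝓝 x := fun x ↦
    (hO.smul x).mem_nhds (by simpa using Set.smul_mem_smul_set (a := x) h1O)
  have h_finite : ∀ x : G, (Λ ∩ x • O).Finite := fun x ↦ by
    have : ((Λ ∩ x • O).encard : ℝ≥0∞) ≠ ⊤ := ((hR x).trans_lt ENNReal.coe_lt_top).ne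
    exact Set.encard_ne_top_iff.1 (by simpa using this)
  obtain ⟨s, hs, h_cover⟩ := TopologicalSpace.countable_cover_nhds h_nhds
  refine (hs.biUnion fun x _ ↦ (h_finite x).countable).mono ?_
  rw [← Set.inter_iUnion₂, h_cover, Set.inter_univ]

end IsRelativelySeparated

variable [IsTopologicalGroup G] [MeasurableSpace G] [BorelSpace G] {μ : Measure G}
  {Λ V : Set G}

theorem tsum_mul_measure_inv_le [μ.IsMulLeftInvariant] {O : Set G}
    (hΛ : Λ.Countable) (hO : IsOpen O) {R : ℝ≥0∞}
    (hR : ∀ x : G, ((Λ ∩ x • O).encard : ℝ≥0∞) ≤ R) {φ ψ : G → ℝ≥0∞} (hψ : AEMeasurable ψ μ)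
    (hφψ : ∀ x, ∀ z ∈ O, φ (x * z) ≤ ψ x) :
    (∑' l : Λ, φ l) * μ O⁻¹ ≤ R * ∫⁻ x, ψ x ∂μ := by
  have : Countable Λ := hΛ.to_subtype
  have hm : ∀ l : G, MeasurableSet (l • O⁻¹) := fun l ↦ (hO.inv.smul l).measurableSet
  have h_term : ∀ l : G, φ l * μ O⁻¹ ≤ ∫⁻ x in l • O⁻¹, ψ x ∂μ := by
    intro l
    rw [← measure_smul μ l, ← setLIntegral_const]
    refine setLIntegral_mono_ae' (hm l) (ae_of_all _ fun x hx ↦ ?_)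
    have hz : x⁻¹ * l ∈ O := by
      simpa [Set.mem_smul_set_iff_inv_smul_mem] using hx
    simpa using hφψ x _ hz
  have h_count : ∀ x, ∑' l : Λ, ((l : G) • O⁻¹).indicator ψ x = (Λ ∩ x • O).encard * ψ x := by
    intro x
    rw [encard_inter_eq_tsum, ← ENNReal.tsum_mul_right]
    refine tsum_congr fun l ↦ ?_
    have h_iff : x ∈ (l : G) • O⁻¹ ↔ (l : G) ∈ x • O := by
      simp [Set.mem_smul_set_iff_inv_smul_mem]
    by_cases h : (l : G) ∈ x • O <;> simp [h, h_iff]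
  calc (∑' l : Λ, φ l) * μ O⁻¹ = ∑' l : Λ, φ l * μ O⁻¹ := ENNReal.tsum_mul_right.symm
    _ ≤ ∑' l : Λ, ∫⁻ x, ((l : G) • O⁻¹).indicator ψ x ∂μ := ENNReal.tsum_le_tsum fun l ↦ by
        rw [lintegral_indicator (hm l)]
        exact h_term l
    _ = ∫⁻ x, ∑' l : Λ, ((l : G) • O⁻¹).indicator ψ x ∂μ :=
        (lintegral_tsum fun l : Λ ↦ hψ.indicator (hm l)).symm
    _ ≤ ∫⁻ x, R * ψ x ∂μ := lintegral_mono fun x ↦ by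
        rw [h_count]
        gcongr
        exact hR x
    _ = R * ∫⁻ x, ψ x ∂μ := lintegral_const_mul'' _ hψ

theorem IsRelativelySeparated.exists_tsum_comp_inv_mul_le [LocallyCompactSpace G]
    [SecondCountableTopology G] [μ.IsHaarMeasure] (hΛ : IsRelativelySeparated Λ) (hV : V ∈ 𝓝 1) :
    ∃ R : ℝ≥0∞, R ≠ ∞ ∧ ∀ φ ψ : G → ℝ≥0∞, AEMeasurable ψ μ →
      (∀ x, ∀ z ∈ V, φ (x * z) ≤ ψ x) →
      ∀ y, ∑' l : Λ, φ (y⁻¹ * l) ≤ R * ∫⁻ x, ψ x ∂μ := by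
  obtain ⟨U, h1U, hU, hU_top⟩ := μ.exists_isOpen_measure_lt_top 1
  obtain ⟨O, hO, h1O, hO_sub, R, hR⟩ := hΛ.exists_subset
    (inter_mem hV (inv_mem_nhds_one G (hU.mem_nhds h1U)))
  have hO_pos : μ O⁻¹ ≠ 0 := (hO.inv.measure_pos μ ⟨1, by simpa using h1O⟩).ne'
  have hO_top : μ O⁻¹ ≠ ∞ :=
    ((measure_mono (Set.inv_subset.2 (hO_sub.trans Set.inter_subset_right))).trans_lt hU_top).ne
  refine ⟨R / μ O⁻¹, ENNReal.div_ne_top ENNReal.coe_ne_top hO_pos, fun φ ψ hψ hφψ y ↦ ?_⟩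
  rw [← lintegral_mul_left_eq_self ψ y⁻¹, ← ENNReal.mul_div_right_comm,
    ENNReal.le_div_iff_mul_le (.inl hO_pos) (.inl hO_top)]
  have hψ_left : AEMeasurable (fun x ↦ ψ (y⁻¹ * x)) μ :=
    AEMeasurable.comp_quasiMeasurePreserving hψ
      (measurePreserving_mul_left μ y⁻¹).quasiMeasurePreserving
  refine tsum_mul_measure_inv_le hΛ.countable hO hR (φ := fun x ↦ φ (y⁻¹ * x)) hψ_left
    fun x z hz ↦ ?_
  rw [← mul_assoc]
  exact hφψ (y⁻¹ * x) z (hO_sub hz).1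

theorem IsRelativelySeparated.exists_encard_inter_smul_le [LocallyCompactSpace G]
    [SecondCountableTopology G] [μ.IsHaarMeasure] (hΛ : IsRelativelySeparated Λ) (hV : V ∈ 𝓝 1) :
    ∃ R : ℝ≥0∞, R ≠ ∞ ∧ ∀ (S : Set G) (x : G),
      ((Λ ∩ x • S).encard : ℝ≥0∞) ≤ R * μ (S * V⁻¹) := by
  obtain ⟨R, hR, h_sampling⟩ := hΛ.exists_tsum_comp_inv_mul_le (μ := μ) (interior_mem_nhds.2 hV)
  refine ⟨R, hR, fun S x ↦ ?_⟩
  have hm : MeasurableSet (S * (interior V)⁻¹) := isOpen_interior.inv.mul_left.measurableSet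
  have h_le : ∀ y, ∀ z ∈ interior V, S.indicator (1 : G → ℝ≥0∞) (y * z) ≤
      (S * (interior V)⁻¹).indicator 1 y := by
    intro y z hz
    by_cases h : y * z ∈ S
    · have hy : y ∈ S * (interior V)⁻¹ :=
        ⟨y * z, h, z⁻¹, Set.inv_mem_inv.2 hz, mul_inv_cancel_right y z⟩
      simp [h, hy]
    · simp [h]
  have h_count := h_sampling _ _ (measurable_one.indicator hm).aemeasurable h_le x
  rw [tsum_indicator_inv_mul, lintegral_indicator_one hm] at h_count
  refine h_count.trans (mul_le_mul_right (measure_mono ?_) _)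
  exact Set.mul_subset_mul_left (Set.inv_subset_inv.2 interior_subset)

end RelativelySeparated

section WindowDensity

variable {G : Type*} [Group G] [MeasurableSpace G]

/-- The least number of points of `Λ` in a translate of the window `S`, per unit of volume. -/
noncomputable def lowerWindowDensity (μ : Measure G) (Λ S : Set G) : ℝ≥0∞ :=
  ⨅ x : G, (Λ ∩ x • S).encard / μ S

/-- The greatest number of points of `Λ` in a translate of the window `S`, per unit of volume. -/
noncomputable def upperWindowDensity (μ : Measure G) (Λ S : Set G) : ℝ≥0∞ :=
  ⨆ x : G, (Λ ∩ x • S).encard / μ S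

/-- The greatest number of points of `Λ` in a translate of the boundary of thickness `C` of the
window `S`, per unit of volume of `S`. -/
noncomputable def boundaryWindowDensity (μ : Measure G) (Λ S C : Set G) : ℝ≥0∞ :=
  ⨆ x : G, (Λ ∩ x • thickBoundary S C).encard / μ S

theorem lowerWindowDensity_le_upperWindowDensity (μ : Measure G) (Λ S : Set G) :
    lowerWindowDensity μ Λ S ≤ upperWindowDensity μ Λ S :=
  iInf_le_iSup

section Comparison

variable [MeasurableMul₂ G] [MeasurableInv G] {μ : Measure G} [μ.IsMulLeftInvariant]
  {Λ S C : Set G} {φ : G → ℝ≥0∞} {a b : ℝ≥0∞}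

theorem lintegral_comp_inv_mul [μ.IsInvInvariant] (φ : G → ℝ≥0∞) (l : G) :
    ∫⁻ y, φ (y⁻¹ * l) ∂μ = ∫⁻ y, φ y ∂μ := by
  rw [← lintegral_inv_eq_self φ, ← lintegral_mul_left_eq_self (fun y ↦ φ y⁻¹) l⁻¹]
  simp

variable [μ.IsInvInvariant]

theorem lintegral_mul_encard_inter_sdiff_le (hΛ : Λ.Countable) (hφ : Measurable φ)
    (hφC : φ.support ⊆ C) (hb : ∀ y, ∑' l : Λ, φ (y⁻¹ * l) ≤ b) :
    (∫⁻ y, φ y ∂μ) * (Λ ∩ (S \ (Sᶜ * C))).encard ≤ b * μ S := by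
  have : Countable Λ := hΛ.to_subtype
  rw [encard_inter_eq_tsum, ← ENNReal.tsum_mul_left]
  calc _ ≤ ∑' l : Λ, ∫⁻ y in S, φ (y⁻¹ * l) ∂μ := ENNReal.tsum_le_tsum fun l ↦ ?_
    _ = ∫⁻ y in S, ∑' l : Λ, φ (y⁻¹ * l) ∂μ :=
        (lintegral_tsum fun l : Λ ↦ (hφ.comp (measurable_inv.mul_const (l : G))).aemeasurable).symm
    _ ≤ ∫⁻ _ in S, b ∂μ := lintegral_mono hb
    _ = b * μ S := setLIntegral_const S b
  by_cases hl : (l : G) ∈ S \ (Sᶜ * C)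
  · have h_support : (fun y ↦ φ (y⁻¹ * l)).support ⊆ S := by
      refine fun y hy ↦ by_contra fun hyS ↦ hl.2 ?_
      exact ⟨y, hyS, y⁻¹ * l, hφC hy, mul_inv_cancel_left y _⟩
    rw [Set.indicator_of_mem hl, Pi.one_apply, mul_one, setLIntegral_eq_of_support_subset h_support,
      lintegral_comp_inv_mul]
  · simp [hl]

theorem mul_measure_le_lintegral_mul_encard (hΛ : Λ.Countable) (hφ : Measurable φ)
    (hφC : φ.support ⊆ C) (hS : MeasurableSet S) (ha : ∀ y, a ≤ ∑' l : Λ, φ (y⁻¹ * l)) :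
    a * μ S ≤ (∫⁻ y, φ y ∂μ) * (Λ ∩ (S * C)).encard := by
  have : Countable Λ := hΛ.to_subtype
  rw [encard_inter_eq_tsum, ← ENNReal.tsum_mul_left]
  calc a * μ S = ∫⁻ _ in S, a ∂μ := (setLIntegral_const S a).symm
    _ ≤ ∫⁻ y in S, ∑' l : Λ, φ (y⁻¹ * l) ∂μ := lintegral_mono ha
    _ = ∑' l : Λ, ∫⁻ y in S, φ (y⁻¹ * l) ∂μ :=
        lintegral_tsum fun l : Λ ↦ (hφ.comp (measurable_inv.mul_const (l : G))).aemeasurable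
    _ ≤ _ := ENNReal.tsum_le_tsum fun l ↦ ?_
  by_cases hl : (l : G) ∈ S * C
  · rw [Set.indicator_of_mem hl, Pi.one_apply, mul_one, ← lintegral_comp_inv_mul φ (l : G)]
    exact setLIntegral_le_lintegral _ _
  · have h_zero : ∀ y ∈ S, φ (y⁻¹ * l) = 0 := fun y hy ↦ by_contra fun h ↦
      hl ⟨y, hy, y⁻¹ * l, hφC h, mul_inv_cancel_left y _⟩
    rw [setLIntegral_congr_fun hS h_zero, lintegral_zero]
    exact zero_le

theorem upperWindowDensity_le (hΛ : Λ.Countable) (hφ : Measurable φ) (hφC : φ.support ⊆ C)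
    (hφ_ne : ∫⁻ y, φ y ∂μ ≠ 0) (hφ_top : ∫⁻ y, φ y ∂μ ≠ ∞) (h1C : 1 ∈ C)
    (hS_ne : μ S ≠ 0) (hS_top : μ S ≠ ∞) (hb : ∀ y, ∑' l : Λ, φ (y⁻¹ * l) ≤ b) :
    upperWindowDensity μ Λ S ≤ b / ∫⁻ y, φ y ∂μ + boundaryWindowDensity μ Λ S C := by
  refine iSup_le fun x ↦ ?_
  have h_interior : ((Λ ∩ x • (S \ (Sᶜ * C))).encard : ℝ≥0∞) ≤ b / (∫⁻ y, φ y ∂μ) * μ S := by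
    have h := lintegral_mul_encard_inter_sdiff_le (μ := μ) (S := x • S) hΛ hφ hφC hb
    rw [measure_smul, ← Set.smul_set_compl, smul_mul_assoc, ← Set.smul_set_sdiff] at h
    rwa [← ENNReal.mul_div_right_comm, ENNReal.le_div_iff_mul_le (.inl hφ_ne) (.inl hφ_top),
      mul_comm]
  have h_split : x • S ⊆ x • (S \ (Sᶜ * C)) ∪ x • thickBoundary S C := by
    rw [← Set.smul_set_union]
    exact Set.smul_set_mono (subset_sdiff_union_thickBoundary h1C)
  calc ((Λ ∩ x • S).encard : ℝ≥0∞) / μ S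
      ≤ (b / (∫⁻ y, φ y ∂μ) * μ S + (Λ ∩ x • thickBoundary S C).encard) / μ S :=
        ENNReal.div_le_div_right
          ((encard_inter_le_add h_split).trans (add_le_add_left h_interior _)) _
    _ = b / ∫⁻ y, φ y ∂μ + (Λ ∩ x • thickBoundary S C).encard / μ S := by
        rw [ENNReal.add_div, ENNReal.mul_div_cancel_right hS_ne hS_top]
    _ ≤ _ := by
        gcongr
        exact le_iSup (fun x ↦ ((Λ ∩ x • thickBoundary S C).encard : ℝ≥0∞) / μ S) x

theorem le_lowerWindowDensity_add (hΛ : Λ.Countable) (hφ : Measurable φ) (hφC : φ.support ⊆ C)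
    (h1C : 1 ∈ C) (hS : MeasurableSet S) (hS_ne : μ S ≠ 0) (hS_top : μ S ≠ ∞)
    (ha : ∀ y, a ≤ ∑' l : Λ, φ (y⁻¹ * l)) :
    a / ∫⁻ y, φ y ∂μ ≤ lowerWindowDensity μ Λ S + boundaryWindowDensity μ Λ S C := by
  rw [lowerWindowDensity, ENNReal.iInf_add]
  refine le_iInf fun x ↦ ?_
  have h_cover : x • S * C ⊆ x • S ∪ x • thickBoundary S C := by
    rw [smul_mul_assoc, ← Set.smul_set_union]
    exact Set.smul_set_mono (mul_subset_union_thickBoundary h1C)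
  have h_count : a * μ S ≤
      (∫⁻ y, φ y ∂μ) * ((Λ ∩ x • S).encard + (Λ ∩ x • thickBoundary S C).encard) := by
    rw [← measure_smul μ x S]
    exact (mul_measure_le_lintegral_mul_encard hΛ hφ hφC (hS.const_smul x) ha).trans
      (mul_le_mul_right (encard_inter_le_add h_cover) _)
  calc a / ∫⁻ y, φ y ∂μ
      ≤ ((Λ ∩ x • S).encard + (Λ ∩ x • thickBoundary S C).encard) / μ S := by
        refine ENNReal.div_le_of_le_mul ?_
        rwa [← ENNReal.mul_div_right_comm, ENNReal.le_div_iff_mul_le (.inl hS_ne) (.inl hS_top),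
          mul_comm _ (∫⁻ y, φ y ∂μ)]
    _ = (Λ ∩ x • S).encard / μ S + (Λ ∩ x • thickBoundary S C).encard / μ S := ENNReal.add_div
    _ ≤ _ := by
        gcongr
        exact le_iSup (fun x ↦ ((Λ ∩ x • thickBoundary S C).encard : ℝ≥0∞) / μ S) x

end Comparison

variable [TopologicalSpace G] [IsTopologicalGroup G] [LocallyCompactSpace G]
  [SecondCountableTopology G] [BorelSpace G] {μ : Measure G} [μ.IsHaarMeasure] {Λ C : Set G}
  {K : ℕ → Set G}

theorem IsStrongFolner.tendsto_boundaryWindowDensity (hK : IsStrongFolner μ K)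
    (hΛ : IsRelativelySeparated Λ) (hC : IsCompact C) :
    Tendsto (fun n ↦ boundaryWindowDensity μ Λ (K n) C) atTop (𝓝 0) := by
  obtain ⟨V, hV, hV1⟩ := exists_compact_mem_nhds (1 : G)
  obtain ⟨R, hR, h_count⟩ := hΛ.exists_encard_inter_smul_le (μ := μ) hV1
  have h_lim := ENNReal.Tendsto.const_mul (hK.tendsto_boundary _ (hC.mul hV.inv)) (.inr hR)
  rw [mul_zero] at h_lim
  refine tendsto_of_tendsto_of_tendsto_of_le_of_le tendsto_const_nhds h_lim
    (fun _ ↦ zero_le) fun n ↦ iSup_le fun x ↦ ?_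
  rw [← mul_div_assoc]
  refine ENNReal.div_le_div_right ((h_count _ x).trans ?_) _
  exact mul_le_mul_right (measure_mono (thickBoundary_mul_subset _ _ _)) _

variable [μ.IsInvInvariant]

theorem IsStrongFolner.limsup_upperWindowDensity_le (hK : IsStrongFolner μ K)
    (hΛ : IsRelativelySeparated Λ) (hC : IsCompact C) {φ : G → ℝ≥0∞} (hφ : Measurable φ)
    (hφC : φ.support ⊆ C) (hφ_ne : ∫⁻ y, φ y ∂μ ≠ 0) (hφ_top : ∫⁻ y, φ y ∂μ ≠ ∞)
    {b : ℝ≥0∞} (hb : ∀ y, ∑' l : Λ, φ (y⁻¹ * l) ≤ b) :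
    limsup (fun n ↦ upperWindowDensity μ Λ (K n)) atTop ≤ b / ∫⁻ y, φ y ∂μ := by
  have h_lim := (hK.tendsto_boundaryWindowDensity hΛ (hC.insert 1)).const_add (b / ∫⁻ y, φ y ∂μ)
  rw [add_zero] at h_lim
  refine (limsup_le_limsup (Eventually.of_forall fun n ↦ ?_)).trans_eq h_lim.limsup_eq
  exact upperWindowDensity_le hΛ.countable hφ (hφC.trans (Set.subset_insert 1 C)) hφ_ne hφ_top
    (Set.mem_insert 1 C) (hK.measure_ne_zero n) (hK.isCompact n).measure_lt_top.ne hb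

theorem IsStrongFolner.le_liminf_lowerWindowDensity [T2Space G] (hK : IsStrongFolner μ K)
    (hΛ : IsRelativelySeparated Λ) (hC : IsCompact C) {φ : G → ℝ≥0∞} (hφ : Measurable φ)
    (hφC : φ.support ⊆ C) {a : ℝ≥0∞} (ha : ∀ y, a ≤ ∑' l : Λ, φ (y⁻¹ * l)) :
    a / ∫⁻ y, φ y ∂μ ≤ liminf (fun n ↦ lowerWindowDensity μ Λ (K n)) atTop := by
  rw [← ENNReal.liminf_add_of_right_tendsto_zero
    (hK.tendsto_boundaryWindowDensity hΛ (hC.insert 1))]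
  refine le_liminf_of_le (by isBoundedDefault) (Eventually.of_forall fun n ↦ ?_)
  exact le_lowerWindowDensity_add hΛ.countable hφ (hφC.trans (Set.subset_insert 1 C))
    (Set.mem_insert 1 C) (hK.isCompact n).measurableSet (hK.measure_ne_zero n)
    (hK.isCompact n).measure_lt_top.ne ha

end WindowDensity

section BeurlingDensity

theorem exists_forall_tendsto_of_limsup_le_liminf {ι : Type*} {p : ι → Prop} {s : ι → ℕ → ℝ≥0∞}
    (h : ∀ i j, p i → p j → limsup (s i) atTop ≤ liminf (s j) atTop) {i₀ : ι} (hi₀ : p i₀)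
    (h_top : limsup (s i₀) atTop ≠ ∞) :
    ∃ D : ℝ≥0, ∀ i, p i → Tendsto (s i) atTop (𝓝 (D : ℝ≥0∞)) := by
  refine ⟨(limsup (s i₀) atTop).toNNReal, fun i hi ↦ ?_⟩
  rw [ENNReal.coe_toNNReal h_top]
  exact tendsto_of_le_liminf_of_limsup_le (h i₀ i hi₀ hi)
    ((h i i₀ hi hi₀).trans liminf_le_limsup)

variable {G : Type*} [Group G] [TopologicalSpace G] [MeasurableSpace G] {μ : Measure G}
  {Λ : Set G}

theorem HasLowerDensity.le_of_hasUpperDensity {D₁ D₂ : ℝ≥0} (h₁ : HasLowerDensity μ Λ D₁)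
    (h₂ : HasUpperDensity μ Λ D₂) : D₁ ≤ D₂ := by
  obtain ⟨K, hK⟩ := h₁.1
  exact_mod_cast le_of_tendsto_of_tendsto' (h₁.2 K hK) (h₂.2 K hK) fun n ↦
    lowerWindowDensity_le_upperWindowDensity μ Λ (K n)

variable [IsTopologicalGroup G] [LocallyCompactSpace G]
  [SecondCountableTopology G] [BorelSpace G] [μ.IsHaarMeasure] {K : ℕ → Set G} {L : Set G}

theorem IsRelativelySeparated.upperWindowDensity_ne_top (hΛ : IsRelativelySeparated Λ)
    (hL : IsCompact L) (hL_ne : μ L ≠ 0) : upperWindowDensity μ Λ L ≠ ∞ := by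
  obtain ⟨V, hV, hV1⟩ := exists_compact_mem_nhds (1 : G)
  obtain ⟨R, hR, h_count⟩ := hΛ.exists_encard_inter_smul_le (μ := μ) hV1
  refine ne_top_of_le_ne_top ?_ (iSup_le fun x ↦ ENNReal.div_le_div_right (h_count L x) _)
  exact ENNReal.div_ne_top (ENNReal.mul_ne_top hR (hL.mul hV.inv).measure_lt_top.ne) hL_ne

variable [T2Space G] [μ.IsInvInvariant]

theorem IsStrongFolner.limsup_le_upperWindowDensity (hK : IsStrongFolner μ K)
    (hΛ : IsRelativelySeparated Λ) (hL : IsCompact L) (hL_ne : μ L ≠ 0) :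
    limsup (fun n ↦ upperWindowDensity μ Λ (K n)) atTop ≤ upperWindowDensity μ Λ L := by
  have hI : ∫⁻ y, L.indicator 1 y ∂μ = μ L := lintegral_indicator_one hL.measurableSet
  rw [upperWindowDensity, ← ENNReal.iSup_div, ← hI]
  refine hK.limsup_upperWindowDensity_le hΛ hL (measurable_one.indicator hL.measurableSet)
    Set.support_indicator_subset (hI ▸ hL_ne) (hI ▸ hL.measure_lt_top.ne) fun y ↦ ?_
  rw [tsum_indicator_inv_mul]
  exact le_iSup (fun x ↦ ((Λ ∩ x • L).encard : ℝ≥0∞)) y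

theorem IsStrongFolner.lowerWindowDensity_le_liminf (hK : IsStrongFolner μ K)
    (hΛ : IsRelativelySeparated Λ) (hL : IsCompact L) (hL_ne : μ L ≠ 0) :
    lowerWindowDensity μ Λ L ≤ liminf (fun n ↦ lowerWindowDensity μ Λ (K n)) atTop := by
  have hI : ∫⁻ y, L.indicator 1 y ∂μ = μ L := lintegral_indicator_one hL.measurableSet
  rw [lowerWindowDensity, ← ENNReal.iInf_div_of_ne hL_ne hL.measure_lt_top.ne, ← hI]
  refine hK.le_liminf_lowerWindowDensity hΛ hL (measurable_one.indicator hL.measurableSet)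
    Set.support_indicator_subset fun y ↦ ?_
  rw [tsum_indicator_inv_mul]
  exact iInf_le (fun x ↦ ((Λ ∩ x • L).encard : ℝ≥0∞)) y

theorem IsRelativelySeparated.exists_hasUpperDensity (hΛ : IsRelativelySeparated Λ)
    (h_folner : ∃ K : ℕ → Set G, IsStrongFolner μ K) : ∃ D : ℝ≥0, HasUpperDensity μ Λ D := by
  obtain ⟨K₀, hK₀⟩ := h_folner
  obtain ⟨D, hD⟩ := exists_forall_tendsto_of_limsup_le_liminf (p := IsStrongFolner μ)
    (s := fun K n ↦ upperWindowDensity μ Λ (K n)) (fun K L hK hL ↦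
      le_liminf_of_le (by isBoundedDefault) <| Eventually.of_forall fun m ↦
        hK.limsup_le_upperWindowDensity hΛ (hL.isCompact m) (hL.measure_ne_zero m)) hK₀
    (ne_top_of_le_ne_top (hΛ.upperWindowDensity_ne_top (hK₀.isCompact 0) (hK₀.measure_ne_zero 0))
      (hK₀.limsup_le_upperWindowDensity hΛ (hK₀.isCompact 0) (hK₀.measure_ne_zero 0)))
  exact ⟨D, ⟨K₀, hK₀⟩, hD⟩

theorem IsRelativelySeparated.exists_hasLowerDensity (hΛ : IsRelativelySeparated Λ)
    (h_folner : ∃ K : ℕ → Set G, IsStrongFolner μ K) : ∃ D : ℝ≥0, HasLowerDensity μ Λ D := by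
  obtain ⟨K₀, hK₀⟩ := h_folner
  have h_le : limsup (fun n ↦ lowerWindowDensity μ Λ (K₀ n)) atTop ≤
      upperWindowDensity μ Λ (K₀ 0) :=
    (limsup_le_limsup <| Eventually.of_forall fun n ↦
      lowerWindowDensity_le_upperWindowDensity μ Λ (K₀ n)).trans
    (hK₀.limsup_le_upperWindowDensity hΛ (hK₀.isCompact 0) (hK₀.measure_ne_zero 0))
  obtain ⟨D, hD⟩ := exists_forall_tendsto_of_limsup_le_liminf (p := IsStrongFolner μ)
    (s := fun K n ↦ lowerWindowDensity μ Λ (K n)) (fun K L hK hL ↦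
      limsup_le_of_le (by isBoundedDefault) <| Eventually.of_forall fun m ↦
        hL.lowerWindowDensity_le_liminf hΛ (hK.isCompact m) (hK.measure_ne_zero m)) hK₀
    (ne_top_of_le_ne_top
      (hΛ.upperWindowDensity_ne_top (hK₀.isCompact 0) (hK₀.measure_ne_zero 0)) h_le)
  exact ⟨D, ⟨K₀, hK₀⟩, hD⟩

end BeurlingDensity

/-! ### Densities and sampling sums -/

section CompactCovering

variable {X : Type*} [TopologicalSpace X] [T2Space X] [SigmaCompactSpace X]
  [MeasurableSpace X] [BorelSpace X]

theorem aecover_compactCovering (μ : Measure X) : AECover μ atTop (compactCovering X) where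
  ae_eventually_mem := Eventually.of_forall fun x ↦ by
    obtain ⟨m, hm⟩ := exists_mem_compactCovering x
    filter_upwards [eventually_ge_atTop m] with n hn using compactCovering_subset X hn hm
  measurableSet n := (isCompact_compactCovering X n).measurableSet

theorem tendsto_setLIntegral_compl_compactCovering {μ : Measure X} {ψ : X → ℝ≥0∞}
    (hψ : AEMeasurable ψ μ) (hψ_top : ∫⁻ x, ψ x ∂μ ≠ ∞) :
    Tendsto (fun n ↦ ∫⁻ x in (compactCovering X n)ᶜ, ψ x ∂μ) atTop (𝓝 0) := by
  have h_cover := aecover_compactCovering μ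
  have h_sub := ENNReal.Tendsto.sub (tendsto_const_nhds (x := ∫⁻ x, ψ x ∂μ))
    (h_cover.lintegral_tendsto_of_nat hψ) (.inl hψ_top)
  rw [tsub_self] at h_sub
  refine h_sub.congr fun n ↦ ?_
  rw [← lintegral_add_compl ψ (h_cover.measurableSet n)]
  exact ENNReal.add_sub_cancel_left
    (ne_top_of_le_ne_top hψ_top (setLIntegral_le_lintegral _ ψ))

end CompactCovering

section DensityBounds

variable {G : Type*} [Group G] [TopologicalSpace G] [IsTopologicalGroup G]
  [MeasurableSpace G] [BorelSpace G] {μ : Measure G} [μ.IsHaarMeasure]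

/-- The essential supremum dominates every pointwise value on the interior because a non-empty
open set has positive Haar measure. -/
theorem enorm_mul_le_localMaximal {Q : Set G} {F : G → ℂ} (hF : Continuous fun x ↦ ‖F x‖) (x : G)
    {z : G} (hz : z ∈ interior Q) : ‖F (x * z)‖ₑ ≤ localMaximal μ Q F x := by
  by_contra! h_lt
  have hF_enorm : Continuous fun w ↦ ‖F (x * w)‖ₑ := by
    simp_rw [← ofReal_norm]
    exact ENNReal.continuous_ofReal.comp (hF.comp (continuous_const_mul x))
  set U := {w : G | localMaximal μ Q F x < ‖F (x * w)‖ₑ} ∩ interior Q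
  have hU : IsOpen U := (isOpen_lt continuous_const hF_enorm).inter isOpen_interior
  have h_ae : ∀ᵐ w ∂μ.restrict (interior Q), ‖F (x * w)‖ₑ ≤ localMaximal μ Q F x :=
    ae_mono (Measure.restrict_mono interior_subset le_rfl) ae_le_essSup
  rw [ae_restrict_iff' isOpen_interior.measurableSet] at h_ae
  refine (hU.measure_pos μ ⟨z, h_lt, hz⟩).ne' (measure_mono_null (fun w hw ↦ ?_) h_ae)
  exact fun h ↦ (h hw.2).not_gt hw.1

variable [T2Space G] [LocallyCompactSpace G] [SecondCountableTopology G]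
  {Λ : Set G} {D : ℝ≥0} {φ ψ : G → ℝ≥0∞}

theorem IsRelativelySeparated.exists_tsum_indicator_compl_tendsto_zero
    (hΛ : IsRelativelySeparated Λ) {V : Set G} (hV : V ∈ 𝓝 1) (hψ : AEMeasurable ψ μ)
    (hψ_top : ∫⁻ x, ψ x ∂μ ≠ ∞) (hφψ : ∀ x, ∀ z ∈ V, φ (x * z) ≤ ψ x) :
    ∃ (C : ℕ → Set G) (t : ℕ → ℝ≥0∞), (∀ n, IsCompact (C n)) ∧ Tendsto t atTop (𝓝 0) ∧
      ∀ n y, ∑' l : Λ, (C n)ᶜ.indicator φ (y⁻¹ * l) ≤ t n := by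
  obtain ⟨W, hW, hWV, hW_compact⟩ := local_compact_nhds hV
  obtain ⟨R, hR, h_sampling⟩ := hΛ.exists_tsum_comp_inv_mul_le (μ := μ) hW
  have hC n : IsCompact (compactCovering G n) := isCompact_compactCovering G n
  refine ⟨fun n ↦ compactCovering G n * W,
    fun n ↦ R * ∫⁻ x in (compactCovering G n)ᶜ, ψ x ∂μ, fun n ↦ (hC n).mul hW_compact, ?_,
    fun n ↦ ?_⟩
  · simpa only [mul_zero] using ENNReal.Tendsto.const_mul
      (tendsto_setLIntegral_compl_compactCovering hψ hψ_top) (.inr hR)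
  · have hC_compl := (hC n).measurableSet.compl
    simp only [← lintegral_indicator hC_compl]
    refine h_sampling _ _ (hψ.indicator hC_compl) fun x z hz ↦ ?_
    by_cases hx : x ∈ compactCovering G n
    · rw [Set.indicator_of_notMem (Set.notMem_compl_iff.2 (Set.mul_mem_mul hx hz))]
      exact zero_le
    · rw [Set.indicator_of_mem (Set.mem_compl hx)]
      exact (Set.indicator_le_self _ φ _).trans (hφψ x z (hWV hz))

variable [μ.IsInvInvariant]

theorem HasUpperDensity.mul_lintegral_le (hD : HasUpperDensity μ Λ D)
    (hΛ : IsRelativelySeparated Λ) (hφ : Measurable φ) (hφ_top : ∫⁻ x, φ x ∂μ ≠ ∞) {b : ℝ≥0∞}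
    (hb : ∀ y, ∑' l : Λ, φ (y⁻¹ * l) ≤ b) : D * ∫⁻ x, φ x ∂μ ≤ b := by
  obtain ⟨K, hK⟩ := hD.1
  refine le_of_tendsto' (ENNReal.Tendsto.const_mul
    ((aecover_compactCovering μ).lintegral_tendsto_of_nat hφ.aemeasurable)
    (.inr ENNReal.coe_ne_top)) fun n ↦ ?_
  have hC := isCompact_compactCovering G n
  rw [← lintegral_indicator hC.measurableSet]
  have h_top : ∫⁻ x, (compactCovering G n).indicator φ x ∂μ ≠ ∞ :=
    ne_top_of_le_ne_top hφ_top (lintegral_mono (Set.indicator_le_self _ φ))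
  by_cases h_zero : ∫⁻ x, (compactCovering G n).indicator φ x ∂μ = 0
  · rw [h_zero, mul_zero]
    exact zero_le
  rw [← ENNReal.le_div_iff_mul_le (.inl h_zero) (.inl h_top), ← (hD.2 K hK).limsup_eq]
  exact hK.limsup_upperWindowDensity_le hΛ hC (hφ.indicator hC.measurableSet)
    Set.support_indicator_subset h_zero h_top fun y ↦
      (ENNReal.tsum_le_tsum fun l ↦ Set.indicator_le_self _ _ _).trans (hb y)

theorem HasLowerDensity.le_mul_lintegral (hD : HasLowerDensity μ Λ D)
    (hΛ : IsRelativelySeparated Λ) {V : Set G} (hV : V ∈ 𝓝 1) (hφ : Measurable φ)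
    (hψ : AEMeasurable ψ μ) (hψ_top : ∫⁻ x, ψ x ∂μ ≠ ∞) (hφψ : ∀ x, ∀ z ∈ V, φ (x * z) ≤ ψ x)
    {a : ℝ≥0∞} (ha : ∀ y, a ≤ ∑' l : Λ, φ (y⁻¹ * l)) : a ≤ D * ∫⁻ x, φ x ∂μ := by
  obtain ⟨K, hK⟩ := hD.1
  obtain ⟨C, t, hC, ht, h_tail⟩ :=
    hΛ.exists_tsum_indicator_compl_tendsto_zero hV hψ hψ_top hφψ
  have h_lim := ht.const_add (D * ∫⁻ x, φ x ∂μ)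
  rw [add_zero] at h_lim
  refine ge_of_tendsto' h_lim fun n ↦ tsub_le_iff_right.1 ?_
  have hφ_le : ∫⁻ x, φ x ∂μ ≤ ∫⁻ x, ψ x ∂μ :=
    lintegral_mono fun x ↦ by simpa only [mul_one] using hφψ x 1 (mem_of_mem_nhds hV)
  have h_sum y : a - t n ≤ ∑' l : Λ, (C n).indicator φ (y⁻¹ * l) := by
    rw [tsub_le_iff_right]
    calc a ≤ ∑' l : Λ, φ (y⁻¹ * l) := ha y
      _ = ∑' l : Λ, (C n).indicator φ (y⁻¹ * l) + ∑' l : Λ, (C n)ᶜ.indicator φ (y⁻¹ * l) := by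
        simp_rw [← ENNReal.tsum_add, Set.indicator_self_add_compl_apply]
      _ ≤ _ := add_le_add_right (h_tail n y) _
  have h_le := hK.le_liminf_lowerWindowDensity hΛ (hC n) (hφ.indicator (hC n).measurableSet)
    Set.support_indicator_subset h_sum
  have h_indicator : ∫⁻ x, (C n).indicator φ x ∂μ ≤ ∫⁻ x, φ x ∂μ :=
    lintegral_mono (Set.indicator_le_self _ φ)
  replace h_le := h_le.trans_eq (hD.2 K hK).liminf_eq
  rw [ENNReal.div_le_iff_le_mul (.inr ENNReal.coe_ne_top)
    (.inl <| ne_top_of_le_ne_top hψ_top (h_indicator.trans hφ_le))] at h_le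
  exact h_le.trans (mul_le_mul_right h_indicator _)

end DensityBounds

/-! ### Matrix coefficients -/

section RepresentationBasics

open scoped ComplexConjugate InnerProductSpace

namespace ProjRep

variable {G H : Type*} [Group G] [MeasurableSpace G]
  [NormedAddCommGroup H] [InnerProductSpace ℂ H] (π : ProjRep G H)

theorem smul_op_one (f : H) : (π.σ 1 1 : ℂ) • π.op 1 f = f := by
  apply (π.op 1).injective
  rw [map_smul, ← π.map_mul, mul_one]

theorem smul_op_inv_mul (x y : G) (f : H) :
    (π.σ x (x⁻¹ * y) : ℂ) • π.op x (π.op (x⁻¹ * y) f) = π.op y f := by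
  rw [← π.map_mul, mul_inv_cancel_left]

theorem op_symm (x : G) (f : H) : (π.op x).symm f = (π.σ 1 1 * π.σ x x⁻¹ : ℂ) • π.op x⁻¹ f := by
  apply (π.op x).injective
  rw [LinearIsometryEquiv.apply_symm_apply, map_smul, mul_smul, ← π.map_mul, mul_inv_cancel,
    π.smul_op_one]

theorem stronglyMeasurable_coeff (g f : H) : StronglyMeasurable (π.coeff g f) :=
  (π.stronglyMeasurable g).inner stronglyMeasurable_const

theorem coeff_add_right (g f₁ f₂ : H) : π.coeff g (f₁ + f₂) = π.coeff g f₁ + π.coeff g f₂ := by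
  ext x
  simp only [coeff, inner_add_right, Pi.add_apply]

theorem coeff_smul_right (c : ℂ) (g f : H) : π.coeff g (c • f) = c • π.coeff g f := by
  ext x
  simp only [coeff, inner_smul_right, Pi.smul_apply, smul_eq_mul]

theorem coeff_zero_right (g : H) : π.coeff g 0 = 0 := by
  ext x
  exact inner_zero_right _

theorem norm_coeff_one (g f : H) : ‖π.coeff g f 1‖ = ‖⟪g, f⟫_ℂ‖ := by
  conv_rhs => rw [← π.smul_op_one g]
  rw [coeff, inner_smul_left, norm_mul, RCLike.norm_conj, Circle.norm_coe, one_mul]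

theorem norm_coeff_one_self (g : H) : ‖π.coeff g g 1‖ = ‖g‖ ^ 2 := by
  rw [norm_coeff_one, inner_self_eq_norm_sq_to_K, norm_pow, RCLike.norm_ofReal, abs_norm]

theorem coeff_op (g f : H) (x y : G) :
    π.coeff g (π.op x f) y = conj (π.σ x (x⁻¹ * y) : ℂ) * π.coeff g f (x⁻¹ * y) := by
  rw [coeff, ← π.smul_op_inv_mul x y g, inner_smul_left, LinearIsometryEquiv.inner_map_map, coeff]

theorem norm_coeff_op (g f : H) (x y : G) :
    ‖π.coeff g (π.op x f) y‖ = ‖π.coeff g f (x⁻¹ * y)‖ := by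
  rw [coeff_op, norm_mul, RCLike.norm_conj, Circle.norm_coe, one_mul]

theorem norm_coeff_inv (g f : H) (x : G) : ‖π.coeff g f x⁻¹‖ = ‖π.coeff f g x‖ := by
  have h_symm : ‖π.coeff g f x⁻¹‖ = ‖⟪(π.op x).symm g, f⟫_ℂ‖ := by
    rw [op_symm, inner_smul_left, norm_mul, RCLike.norm_conj, norm_mul, Circle.norm_coe,
      Circle.norm_coe, one_mul, one_mul, coeff]
  rw [h_symm, ← norm_inner_symm, coeff]
  exact congrArg norm ((π.op x).inner_map_eq_flip f g).symm

end ProjRep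

end RepresentationBasics

section Continuity

open scoped InnerProductSpace

theorem exists_measure_preimage_ball_ne_zero {X E : Type*} [MeasurableSpace X]
    [PseudoMetricSpace E] {μ : Measure X} [NeZero μ] {F : X → E} (hF : StronglyMeasurable F)
    {ε : ℝ} (hε : 0 < ε) : ∃ e : E, μ (F ⁻¹' Metric.ball e ε) ≠ 0 := by
  obtain ⟨t, ht, ht_dense⟩ := hF.isSeparable_range
  by_contra! h_null
  refine NeZero.ne (μ Set.univ) (measure_mono_null (fun x _ ↦ ?_)
    ((measure_biUnion_null_iff ht).2 fun e _ ↦ h_null e))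
  obtain ⟨e, he, hxe⟩ := Metric.mem_closure_iff.1 (ht_dense (Set.mem_range_self x)) ε hε
  exact Set.mem_biUnion he hxe

namespace ProjRep

variable {G H : Type*} [Group G] [MeasurableSpace G]
  [NormedAddCommGroup H] [InnerProductSpace ℂ H] (π : ProjRep G H)

theorem norm_smul_op_inv_mul_sub (x y : G) (g : H) :
    ‖(π.σ x (x⁻¹ * y) : ℂ) • π.op (x⁻¹ * y) g - g‖ = ‖π.op y g - π.op x g‖ := by
  rw [← (π.op x).norm_map, map_sub, map_smul, smul_op_inv_mul]

variable [TopologicalSpace G] [IsTopologicalGroup G] [LocallyCompactSpace G]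
  [SecondCountableTopology G] [BorelSpace G]

/-- Steinhaus: some set on which `π(·) g` varies by less than `ε` has positive Haar measure, so
its quotients `x⁻¹ y` fill a neighbourhood of the identity. -/
theorem eventually_exists_norm_smul_op_sub_lt (g : H) {ε : ℝ} (hε : 0 < ε) :
    ∀ᶠ z in 𝓝 (1 : G), ∃ c : Circle, ‖(c : ℂ) • π.op z g - g‖ < ε := by
  let μ : Measure G := Measure.haar
  obtain ⟨h, h_ne⟩ :=
    exists_measure_preimage_ball_ne_zero (μ := μ) (π.stronglyMeasurable g) (half_pos hε)
  set S := (fun x ↦ π.op x g) ⁻¹' Metric.ball h (ε / 2)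
  have hS : MeasurableSet S :=
    ((π.stronglyMeasurable g).dist stronglyMeasurable_const).measurable measurableSet_Iio
  have hS_inv : 0 < μ S⁻¹ := pos_iff_ne_zero.2 fun h₀ ↦ h_ne ((measure_inv_null μ).1 h₀)
  filter_upwards [Measure.div_mem_nhds_one_of_haar_pos μ S⁻¹ hS.inv hS_inv]
  rintro _ ⟨x, hx, y, hy, rfl⟩
  refine ⟨π.σ x⁻¹ (x⁻¹⁻¹ * y⁻¹), ?_⟩
  have h_dist : dist (π.op y⁻¹ g) (π.op x⁻¹ g) < ε :=
    (dist_triangle_right _ _ h).trans_lt (by linarith [Metric.mem_ball.1 hx, Metric.mem_ball.1 hy])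
  rw [dist_eq_norm, ← norm_smul_op_inv_mul_sub, inv_inv] at h_dist
  simpa only [inv_inv, div_eq_mul_inv] using h_dist

theorem continuousAt_norm_coeff_one (g f : H) : ContinuousAt (fun x ↦ ‖π.coeff g f x‖) 1 := by
  refine Metric.tendsto_nhds.2 fun ε hε ↦ ?_
  have hδ : 0 < ε / (‖f‖ + 1) := by positivity
  filter_upwards [π.eventually_exists_norm_smul_op_sub_lt g hδ] with z ⟨c, hc⟩
  have h_phase : ‖π.coeff g f z‖ = ‖⟪(c : ℂ) • π.op z g, f⟫_ℂ‖ := by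
    rw [inner_smul_left, norm_mul, RCLike.norm_conj, Circle.norm_coe, one_mul, coeff]
  calc dist ‖π.coeff g f z‖ ‖π.coeff g f 1‖
      ≤ ‖⟪(c : ℂ) • π.op z g - g, f⟫_ℂ‖ := by
        rw [h_phase, norm_coeff_one, inner_sub_left, Real.dist_eq]
        exact abs_norm_sub_norm_le _ _
    _ ≤ ‖(c : ℂ) • π.op z g - g‖ * ‖f‖ := norm_inner_le_norm _ _
    _ ≤ ε / (‖f‖ + 1) * ‖f‖ := by gcongr
    _ < ε := by
      rw [div_mul_eq_mul_div, div_lt_iff₀ (by positivity)]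
      exact mul_lt_mul_of_pos_left (lt_add_one _) hε

theorem continuous_norm_coeff (g f : H) : Continuous fun x ↦ ‖π.coeff g f x‖ := by
  refine continuous_iff_continuousAt.2 fun x ↦ ?_
  obtain ⟨f, rfl⟩ := (π.op x).surjective f
  simp_rw [norm_coeff_op]
  refine ContinuousAt.comp (g := fun z ↦ ‖π.coeff g f z‖) ?_ (continuous_const_mul x⁻¹).continuousAt
  rw [inv_mul_cancel]
  exact π.continuousAt_norm_coeff_one g f

end ProjRep

end Continuity

/-! ### Schur's lemma -/

section Schur

namespace ProjRep

variable {G H : Type*} [Group G] [MeasurableSpace G]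
  [NormedAddCommGroup H] [InnerProductSpace ℂ H] {π : ProjRep G H}

theorem IsIrreducible.eq_zero_or_eq_zero_of_mul_eq_zero (hπ : π.IsIrreducible) {S T : H →L[ℂ] H}
    (hS : ∀ x, Commute S (π.op x : H →L[ℂ] H)) (h : S * T = 0) : S = 0 ∨ T = 0 := by
  have h_inv : ∀ x, ∀ f ∈ S.ker, π.op x f ∈ S.ker := fun x f hf ↦ by
    rw [LinearMap.mem_ker] at hf ⊢
    have := DFunLike.congr_fun (hS x).eq f
    exact this.trans ((congrArg (π.op x) hf).trans (map_zero _))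
  rcases hπ S.ker S.isClosed_ker h_inv with h_bot | h_top
  · refine .inr (ContinuousLinearMap.ext fun f ↦ ?_)
    exact (Submodule.mem_bot ℂ).1 (h_bot ▸ LinearMap.mem_ker.2 (DFunLike.congr_fun h f))
  · refine .inl (ContinuousLinearMap.ext fun f ↦ ?_)
    exact LinearMap.mem_ker.1 (h_top ▸ Submodule.mem_top)

variable [CompleteSpace H] {T : H →L[ℂ] H}

/-- Irreducibility forbids `T - c` from having both a positive and a negative part, as their
product vanishes. -/
theorem IsIrreducible.le_algebraMap_or_algebraMap_le (hπ : π.IsIrreducible) (hT : IsSelfAdjoint T)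
    (h_comm : ∀ x, Commute T (π.op x : H →L[ℂ] H)) (c : ℝ) :
    T ≤ algebraMap ℝ _ c ∨ algebraMap ℝ _ c ≤ T := by
  have hS : IsSelfAdjoint (T - algebraMap ℝ (H →L[ℂ] H) c) := hT.sub (.algebraMap _ (.all c))
  have hS_comm x : Commute (T - algebraMap ℝ (H →L[ℂ] H) c)⁺ (π.op x : H →L[ℂ] H) :=
    ((h_comm x).sub_left (Algebra.commute_algebraMap_left c _)).cfcₙ_real _
  rcases hπ.eq_zero_or_eq_zero_of_mul_eq_zero hS_comm (CFC.posPart_mul_negPart _) with h | h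
  · rw [CFC.posPart_eq_zero_iff _ hS, sub_nonpos] at h
    exact .inl h
  · rw [CFC.negPart_eq_zero_iff _ hS, sub_nonneg] at h
    exact .inr h

theorem IsIrreducible.exists_eq_algebraMap_of_isSelfAdjoint [Nontrivial H] (hπ : π.IsIrreducible)
    (hT : IsSelfAdjoint T) (h_comm : ∀ x, Commute T (π.op x : H →L[ℂ] H)) :
    ∃ c : ℝ, T = algebraMap ℝ _ c := by
  obtain ⟨a, ha⟩ : (spectrum ℝ T).Nonempty := ContinuousFunctionalCalculus.spectrum_nonempty T hT
  have h_le : ∀ s ∈ spectrum ℝ T, ∀ t ∈ spectrum ℝ T, s ≤ t := by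
    intro s hs t ht
    by_contra! h_lt
    obtain ⟨c, htc, hcs⟩ := exists_between h_lt
    rcases hπ.le_algebraMap_or_algebraMap_le hT h_comm c with h | h
    · exact hcs.not_ge ((le_algebraMap_iff_spectrum_le hT).1 h s hs)
    · exact htc.not_ge ((algebraMap_le_iff_le_spectrum hT).1 h t ht)
  refine ⟨a, CFC.eq_algebraMap_of_spectrum_subset_singleton T a fun b hb ↦ ?_⟩
  exact le_antisymm (h_le b hb a ha) (h_le a ha b hb)

end ProjRep

end Schur

section Gram

open scoped InnerProductSpace

variable {𝕜 E F : Type*} [RCLike 𝕜] [NormedAddCommGroup E] [InnerProductSpace 𝕜 E]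
  [NormedAddCommGroup F] [InnerProductSpace 𝕜 F]

/-- The weak form of `(1 + A†A) u = h`, which makes sense for an unbounded operator `A` without
speaking of its adjoint. -/
def IsGramSolution (A : E →ₗ.[𝕜] F) (u : A.domain) (h : E) : Prop :=
  ∀ v : A.domain, ⟪(v : E), u⟫_𝕜 + ⟪A v, A u⟫_𝕜 = ⟪(v : E), h⟫_𝕜

theorem IsGramSolution.unique {A : E →ₗ.[𝕜] F} {u u' : A.domain} {h : E}
    (hu : IsGramSolution A u h) (hu' : IsGramSolution A u' h) : u = u' := by
  have h_zero : ⟪((u - u' : A.domain) : E), (u - u' : A.domain)⟫_𝕜 +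
      ⟪A (u - u'), A (u - u')⟫_𝕜 = 0 := by
    rw [A.map_sub u u', inner_sub_right (A u - A u'), Submodule.coe_sub, inner_sub_right,
      ← Submodule.coe_sub, ← A.map_sub]
    linear_combination hu (u - u') - hu' (u - u')
  have h_norm : ‖((u - u' : A.domain) : E)‖ ^ 2 + ‖A (u - u')‖ ^ 2 = 0 := by
    rw [inner_self_eq_norm_sq_to_K, inner_self_eq_norm_sq_to_K] at h_zero
    exact_mod_cast h_zero
  have h_sub : ((u - u' : A.domain) : E) = 0 := by
    rw [← norm_eq_zero, ← sq_eq_zero_iff]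
    linarith [sq_nonneg ‖((u - u' : A.domain) : E)‖, sq_nonneg ‖A (u - u')‖]
  exact sub_eq_zero.1 (Subtype.ext h_sub)

/-- von Neumann: if `j` projects the graph of `A`, a Hilbert space, to its first coordinate, then
`(1 + A†A)⁻¹ = j j†`. -/
theorem exists_isGramSolution [CompleteSpace E] [CompleteSpace F] {A : E →ₗ.[𝕜] F}
    (hA : A.IsClosed) :
    ∃ T : E →L[𝕜] E, IsSelfAdjoint T ∧ ∀ h, ∃ u : A.domain, u = T h ∧ IsGramSolution A u h := by
  let Γ : Submodule 𝕜 (WithLp 2 (E × F)) :=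
    A.graph.comap (WithLp.linearEquiv 2 𝕜 (E × F)).toLinearMap
  have : CompleteSpace Γ :=
    (hA.preimage (WithLp.prod_continuous_ofLp 2 E F)).completeSpace_coe
  let j : Γ →L[𝕜] E := WithLp.fstL 2 𝕜 E F ∘L Γ.subtypeL
  refine ⟨j ∘L j.adjoint, (ContinuousLinearMap.isPositive_self_comp_adjoint j).isSelfAdjoint,
    fun h ↦ ?_⟩
  obtain ⟨u, hu_fst, hu_snd⟩ := (LinearPMap.mem_graph_iff A).1 (j.adjoint h).2
  refine ⟨u, hu_fst, fun v ↦ ?_⟩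
  have h_adj := j.adjoint_inner_right ⟨WithLp.toLp 2 (v, A v), A.mem_graph v⟩ h
  rw [Submodule.coe_inner, WithLp.prod_inner_apply] at h_adj
  rw [hu_fst, hu_snd]
  exact h_adj

end Gram

section ClosedIntertwiner

open scoped InnerProductSpace

namespace ProjRep

variable {G H F : Type*} [Group G] [MeasurableSpace G]
  [NormedAddCommGroup H] [InnerProductSpace ℂ H] [NormedAddCommGroup F] [InnerProductSpace ℂ F]

/-- The form `⟪A f, A h⟫` of the unbounded operator `A`, domain included, is invariant under the
representation. -/
structure IsFormInvariant (π : ProjRep G H) (A : H →ₗ.[ℂ] F) : Prop where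
  op_mem (x : G) (f : A.domain) : π.op x f ∈ A.domain
  inner_op (x : G) (f h : A.domain) :
    ⟪A ⟨π.op x f, op_mem x f⟩, A ⟨π.op x h, op_mem x h⟩⟫_ℂ = ⟪A f, A h⟫_ℂ

variable {π : ProjRep G H} {A : H →ₗ.[ℂ] F}

theorem IsFormInvariant.isGramSolution_op (hA : π.IsFormInvariant A) {u : A.domain} {h : H}
    (hu : IsGramSolution A u h) (x : G) :
    IsGramSolution A ⟨π.op x u, hA.op_mem x u⟩ (π.op x h) := by
  intro v
  have hw : (π.op x).symm v ∈ A.domain := by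
    rw [op_symm]
    exact A.domain.smul_mem _ (hA.op_mem x⁻¹ v)
  obtain ⟨w, rfl⟩ : ∃ w : A.domain, v = ⟨π.op x w, hA.op_mem x w⟩ :=
    ⟨⟨_, hw⟩, Subtype.ext ((π.op x).apply_symm_apply v).symm⟩
  rw [hA.inner_op, LinearIsometryEquiv.inner_map_map, LinearIsometryEquiv.inner_map_map]
  exact hu w

/-- Schur's lemma for a closed operator: apply the bounded case to `(1 + A†A)⁻¹`. -/
theorem IsIrreducible.exists_inner_eq_mul_inner [CompleteSpace H] [CompleteSpace F]
    (hπ : π.IsIrreducible) (hA : A.IsClosed) (hA_inv : π.IsFormInvariant A)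
    (hA_ne : A.domain ≠ ⊥) :
    A.domain = ⊤ ∧ ∃ c : ℝ, ∀ f h : A.domain, ⟪A f, A h⟫_ℂ = c * ⟪(f : H), h⟫_ℂ := by
  obtain ⟨f₀, hf₀, hf₀_ne⟩ := Submodule.exists_mem_ne_zero_of_ne_bot hA_ne
  have : Nontrivial H := ⟨f₀, 0, hf₀_ne⟩
  obtain ⟨T, hT, h_sol⟩ := exists_isGramSolution hA
  choose u hu h_gram using h_sol
  have h_comm (x : G) : Commute T (π.op x : H →L[ℂ] H) := by
    ext h
    have h_eq := (h_gram (π.op x h)).unique (hA_inv.isGramSolution_op (h_gram h) x)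
    simpa [hu] using congrArg ((↑) : A.domain → H) h_eq
  obtain ⟨c, rfl⟩ := hπ.exists_eq_algebraMap_of_isSelfAdjoint hT h_comm
  replace hu (h : H) : (u h : H) = (c : ℂ) • h := by
    simpa [Algebra.algebraMap_eq_smul_one] using hu h
  have hc : (c : ℂ) ≠ 0 := by
    intro hc
    have hu₀ : u f₀ = 0 := Subtype.ext (by rw [hu, hc, zero_smul, Submodule.coe_zero])
    have h_zero := h_gram f₀ ⟨f₀, hf₀⟩
    rw [hu₀, A.map_zero, Submodule.coe_zero, inner_zero_right, inner_zero_right, add_zero] at h_zero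
    exact hf₀_ne (inner_self_eq_zero.1 h_zero.symm)
  have hu_inv (h : H) : (u ((c : ℂ)⁻¹ • h) : H) = h := by rw [hu, smul_inv_smul₀ hc]
  refine ⟨eq_top_iff.2 fun f _ ↦ hu_inv f ▸ (u _).2, c⁻¹ - 1, fun f h ↦ ?_⟩
  have h_eq := h_gram ((c : ℂ)⁻¹ • (h : H)) f
  rw [Subtype.ext (hu_inv h), inner_smul_right] at h_eq
  push_cast
  linear_combination h_eq

end ProjRep

end ClosedIntertwiner

/-! ### The formal degree -/

section FormalDegree

open scoped InnerProductSpace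

theorem sesqForm_ext {E : Type*} [AddCommGroup E] [Module ℂ E] {S T : E →ₗ⋆[ℂ] E →ₗ[ℂ] ℂ}
    (h : ∀ a, S a a = T a a) : S = T := by
  have h_alt : (S - T).IsAlt := fun a ↦ sub_eq_zero.2 (h a)
  refine sub_eq_zero.1 (LinearMap.ext₂ fun a b ↦ ?_)
  have h_neg := h_alt.neg a b
  have h_neg_I := h_alt.neg (Complex.I • a) b
  rw [map_smulₛₗ, LinearMap.smul_apply, map_smul, ← h_neg, Complex.conj_I] at h_neg_I
  simp only [smul_eq_mul] at h_neg_I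
  rw [LinearMap.zero_apply, LinearMap.zero_apply]
  linear_combination (-Complex.I / 2) * h_neg_I + ((S - T) a b) * Complex.I_sq

theorem inner_self_eq_ofReal_norm_sq {E : Type*} [NormedAddCommGroup E] [InnerProductSpace ℂ E]
    (f : E) : ⟪f, f⟫_ℂ = ((‖f‖ ^ 2 : ℝ) : ℂ) := by
  rw [inner_self_eq_norm_sq_to_K, Complex.ofReal_pow]
  rfl

namespace ProjRep

section CoeffLp

variable {G H : Type*} [Group G] [MeasurableSpace G]
  [NormedAddCommGroup H] [InnerProductSpace ℂ H] {π : ProjRep G H} {μ : Measure G} {g : H}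

theorem inner_coeff_eq_mul_inner (f₁ f₂ g₁ g₂ : H) (x : G) :
    ⟪π.coeff g₂ f₂ x, π.coeff g₁ f₁ x⟫_ℂ = ⟪π.op x g₁, f₁⟫_ℂ * ⟪f₂, π.op x g₂⟫_ℂ := by
  rw [RCLike.inner_apply, coeff, coeff, inner_conj_symm]

variable (π μ g) in
/-- The coefficient transform `f ↦ V_g f` as an unbounded operator from `H` to `L²`, with its
maximal domain. -/
noncomputable def coeffLp : H →ₗ.[ℂ] Lp ℂ 2 μ where
  domain :=
    { carrier := {f | MemLp (π.coeff g f) 2 μ}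
      add_mem' := fun hf hh ↦ by
        rw [Set.mem_ofPred_eq, coeff_add_right]
        exact hf.add hh
      zero_mem' := by
        rw [Set.mem_ofPred_eq, coeff_zero_right]
        exact MemLp.zero
      smul_mem' := fun c _ hf ↦ by
        rw [Set.mem_ofPred_eq, coeff_smul_right]
        exact hf.const_smul c }
  toFun :=
    { toFun := fun f ↦ f.2.toLp
      map_add' := fun f h ↦ by
        rw [← MemLp.toLp_add]
        exact MemLp.toLp_congr _ _ (.of_eq (coeff_add_right ..))
      map_smul' := fun c f ↦ by
        rw [← MemLp.toLp_const_smul]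
        exact MemLp.toLp_congr _ _ (.of_eq (coeff_smul_right ..)) }

theorem coeffLp_ae_eq (f : (π.coeffLp μ g).domain) : π.coeffLp μ g f =ᵐ[μ] π.coeff g f :=
  f.2.coeFn_toLp

theorem mem_coeffLp_graph {f : H} {F : Lp ℂ 2 μ} :
    (f, F) ∈ (π.coeffLp μ g).graph ↔ F =ᵐ[μ] π.coeff g f := by
  rw [LinearPMap.mem_graph_iff]
  constructor
  · rintro ⟨h, rfl, rfl⟩
    exact coeffLp_ae_eq h
  · intro h
    have hf : MemLp (π.coeff g f) 2 μ := (memLp_congr_ae h).1 (Lp.memLp F)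
    exact ⟨⟨f, hf⟩, rfl, Lp.ext ((coeffLp_ae_eq ⟨f, hf⟩).trans h.symm)⟩

theorem isClosed_coeffLp : (π.coeffLp μ g).IsClosed := by
  refine IsSeqClosed.isClosed fun u p hu hp ↦ mem_coeffLp_graph.2 ?_
  obtain ⟨n, hn, h_ae⟩ :=
    (tendstoInMeasure_of_tendsto_Lp ((continuous_snd.tendsto p).comp hp)).exists_seq_tendsto_ae
  filter_upwards [h_ae, ae_all_iff.2 fun k ↦ mem_coeffLp_graph.1 (hu k)] with x hx hux
  refine tendsto_nhds_unique hx ?_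
  simp_rw [Function.comp_apply, hux]
  have h_cont : Continuous fun f ↦ π.coeff g f x := continuous_const.inner continuous_id
  exact (h_cont.tendsto _).comp (((continuous_fst.tendsto p).comp hp).comp hn.tendsto_atTop)

theorem inner_coeffLp (f h : (π.coeffLp μ g).domain) :
    ⟪π.coeffLp μ g f, π.coeffLp μ g h⟫_ℂ = ∫ x, ⟪π.coeff g f x, π.coeff g h x⟫_ℂ ∂μ := by
  rw [L2.inner_def]
  refine integral_congr_ae ?_
  filter_upwards [coeffLp_ae_eq f, coeffLp_ae_eq h] with x hf hh
  rw [hf, hh]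

end CoeffLp

section Invariance

variable {G H : Type*} [Group G] [MeasurableSpace G]
  [NormedAddCommGroup H] [InnerProductSpace ℂ H] {π : ProjRep G H} {μ : Measure G} {g f : H}

theorem memLp_coeff_op [MeasurableMul G] [μ.IsMulLeftInvariant] (hf : MemLp (π.coeff g f) 2 μ)
    (x : G) : MemLp (π.coeff g (π.op x f)) 2 μ :=
  (hf.comp_measurePreserving (measurePreserving_mul_left μ x⁻¹)).congr_norm
    (π.stronglyMeasurable_coeff _ _).aestronglyMeasurable
    (.of_forall fun y ↦ (π.norm_coeff_op g f x y).symm)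

theorem memLp_coeff_swap [MeasurableInv G] [μ.IsInvInvariant] (hf : MemLp (π.coeff g f) 2 μ) :
    MemLp (π.coeff f g) 2 μ :=
  (hf.comp_measurePreserving (Measure.measurePreserving_inv μ)).congr_norm
    (π.stronglyMeasurable_coeff _ _).aestronglyMeasurable
    (.of_forall fun x ↦ π.norm_coeff_inv g f x)

theorem inner_coeff_op (g f h : H) (x y : G) :
    ⟪π.coeff g (π.op x f) y, π.coeff g (π.op x h) y⟫_ℂ =
      ⟪π.coeff g f (x⁻¹ * y), π.coeff g h (x⁻¹ * y)⟫_ℂ := by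
  rw [coeff_op, coeff_op, RCLike.inner_apply, RCLike.inner_apply, _root_.map_mul,
    mul_mul_mul_comm, RCLike.mul_conj, RCLike.norm_conj, Circle.norm_coe]
  simp

theorem isFormInvariant_coeffLp [MeasurableMul G] [μ.IsMulLeftInvariant] :
    π.IsFormInvariant (π.coeffLp μ g) where
  op_mem x f := memLp_coeff_op f.2 x
  inner_op x f h := by
    simp_rw [inner_coeffLp, inner_coeff_op]
    exact integral_mul_left_eq_self (fun y ↦ ⟪π.coeff g f y, π.coeff g h y⟫_ℂ) x⁻¹

theorem integral_norm_coeff_sq_swap [MeasurableInv G] [μ.IsInvInvariant] (g f : H) :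
    ∫ x, ‖π.coeff f g x‖ ^ 2 ∂μ = ∫ x, ‖π.coeff g f x‖ ^ 2 ∂μ := by
  simp_rw [← integral_inv_eq_self (fun x ↦ ‖π.coeff g f x‖ ^ 2) μ, norm_coeff_inv]

theorem IsIrreducible.exists_integral_inner_coeff [CompleteSpace H] [MeasurableMul G]
    [μ.IsMulLeftInvariant] (hπ : π.IsIrreducible) (hf : f ≠ 0) (h_mem : MemLp (π.coeff g f) 2 μ) :
    (∀ f, MemLp (π.coeff g f) 2 μ) ∧
      ∃ c : ℝ, ∀ f h, ∫ x, ⟪π.coeff g f x, π.coeff g h x⟫_ℂ ∂μ = c * ⟪f, h⟫_ℂ := by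
  obtain ⟨h_top, c, hc⟩ := hπ.exists_inner_eq_mul_inner isClosed_coeffLp
    (isFormInvariant_coeffLp (μ := μ) (g := g)) ((Submodule.ne_bot_iff _).2 ⟨f, h_mem, hf⟩)
  have h_all (f : H) : f ∈ (π.coeffLp μ g).domain := h_top ▸ Submodule.mem_top
  exact ⟨h_all, c, fun f h ↦ (inner_coeffLp ⟨f, h_all f⟩ ⟨h, h_all h⟩).symm.trans (hc _ _)⟩

theorem IsDiscreteSeries.memLp_coeff [CompleteSpace H] [MeasurableMul G] [MeasurableInv G]
    [μ.IsMulLeftInvariant] [μ.IsInvInvariant] (hπ : π.IsDiscreteSeries μ) (g f : H) :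
    MemLp (π.coeff g f) 2 μ := by
  obtain ⟨hπ, e, he, h_mem⟩ := hπ
  have h_swap : MemLp (π.coeff g e) 2 μ :=
    memLp_coeff_swap ((hπ.exists_integral_inner_coeff he h_mem).1 g)
  exact (hπ.exists_integral_inner_coeff he h_swap).1 f

theorem IsDiscreteSeries.integrable_inner_mul_inner [CompleteSpace H] [MeasurableMul G]
    [MeasurableInv G] [μ.IsMulLeftInvariant] [μ.IsInvInvariant] (hπ : π.IsDiscreteSeries μ)
    (f₁ f₂ g₁ g₂ : H) : Integrable (fun x ↦ ⟪π.op x g₁, f₁⟫_ℂ * ⟪f₂, π.op x g₂⟫_ℂ) μ := by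
  simp_rw [← inner_coeff_eq_mul_inner]
  exact (hπ.memLp_coeff g₁ f₁).integrable_mul (hπ.memLp_coeff g₂ f₂).star

end Invariance

section Orthogonality

variable {G H : Type*} [Group G] [TopologicalSpace G] [IsTopologicalGroup G]
  [LocallyCompactSpace G] [SecondCountableTopology G] [MeasurableSpace G] [BorelSpace G]
  [NormedAddCommGroup H] [InnerProductSpace ℂ H] {π : ProjRep G H} {μ : Measure G}
  [μ.IsHaarMeasure]

theorem integral_norm_coeff_self_sq_pos {g : H} (hg : g ≠ 0) (h_mem : MemLp (π.coeff g g) 2 μ) :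
    0 < ∫ x, ‖π.coeff g g x‖ ^ 2 ∂μ := by
  refine integral_pos_of_integrable_nonneg_nonzero (x := 1)
    ((π.continuous_norm_coeff g g).pow 2) (h_mem.integrable_norm_pow two_ne_zero)
    (fun x ↦ sq_nonneg _) ?_
  rw [norm_coeff_one_self]
  positivity

variable [CompleteSpace H]

theorem IsDiscreteSeries.exists_integral_inner_coeff [μ.IsInvInvariant]
    (hπ : π.IsDiscreteSeries μ) :
    ∃ k : ℝ, 0 < k ∧ ∀ g f h,
      ∫ x, ⟪π.coeff g f x, π.coeff g h x⟫_ℂ ∂μ = k * ‖g‖ ^ 2 * ⟪f, h⟫_ℂ := by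
  have h_mem := hπ.memLp_coeff
  obtain ⟨hπ, e, he, -⟩ := hπ
  choose c hc using fun g ↦ (hπ.exists_integral_inner_coeff he (h_mem g e)).2
  have h_norm (g f : H) : ∫ x, ‖π.coeff g f x‖ ^ 2 ∂μ = c g * ‖f‖ ^ 2 := by
    have h_diag := hc g f f
    simp_rw [inner_self_eq_ofReal_norm_sq, integral_complex_ofReal] at h_diag
    exact_mod_cast h_diag
  have h_swap (g : H) : c g * ‖e‖ ^ 2 = c e * ‖g‖ ^ 2 := by
    rw [← h_norm, ← h_norm, integral_norm_coeff_sq_swap]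
  have he_pos : 0 < ‖e‖ ^ 2 := by positivity
  have hce : 0 < c e := by
    have h_pos := integral_norm_coeff_self_sq_pos he (h_mem e e)
    rw [h_norm] at h_pos
    exact pos_of_mul_pos_left h_pos he_pos.le
  refine ⟨c e / ‖e‖ ^ 2, div_pos hce he_pos, fun g f h ↦ ?_⟩
  have hcg : c g = c e / ‖e‖ ^ 2 * ‖g‖ ^ 2 := by
    rw [div_mul_eq_mul_div, eq_div_iff he_pos.ne', h_swap]
  rw [hc, hcg]
  push_cast
  rfl

theorem IsDiscreteSeries.exists_isFormalDegree [μ.IsInvInvariant] (hπ : π.IsDiscreteSeries μ) :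
    ∃ d : ℝ, π.IsFormalDegree μ d := by
  obtain ⟨k, hk, h_diag⟩ := hπ.exists_integral_inner_coeff
  have h_int := hπ.integrable_inner_mul_inner
  refine ⟨k⁻¹, inv_pos.2 hk, fun f₁ f₂ g₁ g₂ ↦ ⟨h_int f₁ f₂ g₁ g₂, ?_⟩⟩
  let S : H →ₗ⋆[ℂ] H →ₗ[ℂ] ℂ := LinearMap.mk₂'ₛₗ (starRingEnd ℂ) (RingHom.id ℂ)
    (fun g₁ g₂ ↦ ∫ x, ⟪π.op x g₁, f₁⟫_ℂ * ⟪f₂, π.op x g₂⟫_ℂ ∂μ)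
    (fun a b g ↦ by
      simp only [map_add, inner_add_left, add_mul, integral_add (h_int _ _ _ _) (h_int _ _ _ _)])
    (fun z a b ↦ by
      simp only [map_smul, inner_smul_left, mul_assoc, integral_const_mul, smul_eq_mul])
    (fun g a b ↦ by
      simp only [map_add, inner_add_right, mul_add, integral_add (h_int _ _ _ _) (h_int _ _ _ _)])
    (fun z a b ↦ by
      simp only [map_smul, inner_smul_right, mul_left_comm _ z, integral_const_mul, smul_eq_mul,
        RingHom.id_apply])
  have hS : S = ((k : ℂ) * ⟪f₂, f₁⟫_ℂ) • innerₛₗ ℂ := sesqForm_ext fun g ↦ by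
    have h_eq := h_diag g f₂ f₁
    simp_rw [inner_coeff_eq_mul_inner] at h_eq
    refine h_eq.trans ?_
    rw [LinearMap.smul_apply, LinearMap.smul_apply, innerₛₗ_apply_apply, smul_eq_mul,
      inner_self_eq_ofReal_norm_sq, mul_right_comm, Complex.ofReal_pow]
  rw [inner_conj_symm, Complex.ofReal_inv, inv_inv]
  exact DFunLike.congr_fun (DFunLike.congr_fun hS g₁) g₂

end Orthogonality

end ProjRep

end FormalDegree

/-! ### Frames -/

section Frame

namespace ProjRep

variable {G H : Type*} [Group G] [MeasurableSpace G]
  [NormedAddCommGroup H] [InnerProductSpace ℂ H] {π : ProjRep G H} {Λ : Set G} {g : H} {A B : ℝ}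

theorem IsFrame.tsum_enorm_translate_sq (h : π.IsFrame Λ g A B) (y : G) :
    ∑' l : Λ, ‖π.coeff g g (y⁻¹ * l)‖ₑ ^ 2 =
      ENNReal.ofReal (∑' l : Λ, ‖π.coeff g (π.op y g) l‖ ^ 2) := by
  rw [ENNReal.ofReal_tsum_of_nonneg (fun l ↦ sq_nonneg _) (h.summable _)]
  refine tsum_congr fun l ↦ ?_
  rw [norm_coeff_op, ENNReal.ofReal_pow (norm_nonneg _), ofReal_norm]

theorem IsFrame.tsum_enorm_translate_sq_le (h : π.IsFrame Λ g A B) (y : G) :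
    ∑' l : Λ, ‖π.coeff g g (y⁻¹ * l)‖ₑ ^ 2 ≤ ENNReal.ofReal (B * ‖g‖ ^ 2) := by
  rw [h.tsum_enorm_translate_sq, ← (π.op y).norm_map g]
  exact ENNReal.ofReal_le_ofReal (h.upper _)

theorem IsFrame.le_tsum_enorm_translate_sq (h : π.IsFrame Λ g A B) (y : G) :
    ENNReal.ofReal (A * ‖g‖ ^ 2) ≤ ∑' l : Λ, ‖π.coeff g g (y⁻¹ * l)‖ₑ ^ 2 := by
  rw [h.tsum_enorm_translate_sq, ← (π.op y).norm_map g]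
  exact ENNReal.ofReal_le_ofReal (h.lower _)

theorem IsFrame.ne_zero [Nontrivial H] (h : π.IsFrame Λ g A B) : g ≠ 0 := by
  rintro rfl
  obtain ⟨f, hf⟩ := exists_ne (0 : H)
  have h_lower : A * ‖f‖ ^ 2 ≤ 0 := by simpa [coeff] using h.lower f
  have h_pos : 0 < A * ‖f‖ ^ 2 := mul_pos h.lower_pos (by positivity)
  exact h_lower.not_gt h_pos

theorem IsFormalDegree.lintegral_enorm_coeff_self_sq {μ : Measure G} {d : ℝ}
    (hd : π.IsFormalDegree μ d) (g : H) :
    ∫⁻ x, ‖π.coeff g g x‖ₑ ^ 2 ∂μ = ENNReal.ofReal (d⁻¹ * ‖g‖ ^ 4) := by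
  obtain ⟨h_int, h_eq⟩ := hd.2 g g g g
  simp_rw [← inner_coeff_eq_mul_inner, inner_self_eq_ofReal_norm_sq] at h_int h_eq
  have h_sq_int : Integrable (fun x ↦ ‖π.coeff g g x‖ ^ 2) μ := h_int.re
  have h_sq_eq : ∫ x, ‖π.coeff g g x‖ ^ 2 ∂μ = d⁻¹ * ‖g‖ ^ 4 := by
    rw [integral_complex_ofReal, Complex.conj_ofReal] at h_eq
    rw [show ‖g‖ ^ 4 = ‖g‖ ^ 2 * ‖g‖ ^ 2 by ring, ← mul_assoc]
    exact_mod_cast h_eq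
  rw [← h_sq_eq, ofReal_integral_eq_lintegral_ofReal h_sq_int (.of_forall fun x ↦ sq_nonneg _)]
  simp_rw [ENNReal.ofReal_pow (norm_nonneg _), ofReal_norm]

section Topological

variable [TopologicalSpace G] [IsTopologicalGroup G] [LocallyCompactSpace G]
  [SecondCountableTopology G] [BorelSpace G]

/-- If `|V_g g| > ‖g‖² / 2` on `O`, the Bessel inequality for `π(x) g` bounds the number of points
of `Λ` in `x O`. -/
theorem IsFrame.isRelativelySeparated (h : π.IsFrame Λ g A B) (hg : g ≠ 0) :
    IsRelativelySeparated Λ := by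
  let O : Set G := {x | ‖g‖ ^ 2 / 2 < ‖π.coeff g g x‖}
  let c : ℝ≥0∞ := ENNReal.ofReal (‖g‖ ^ 2 / 2) ^ 2
  have hc_zero : c ≠ 0 := pow_ne_zero 2 (ENNReal.ofReal_pos.2 (by positivity)).ne'
  have hc_top : c ≠ ∞ := ENNReal.pow_ne_top ENNReal.ofReal_ne_top
  have h_one : (1 : G) ∈ O := by
    rw [Set.mem_ofPred_eq, norm_coeff_one_self]
    exact half_lt_self (by positivity)
  refine ⟨O, isOpen_lt continuous_const (π.continuous_norm_coeff g g), h_one,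
    (ENNReal.ofReal (B * ‖g‖ ^ 2) / c).toNNReal, fun x ↦ ?_⟩
  rw [ENNReal.coe_toNNReal (ENNReal.div_ne_top ENNReal.ofReal_ne_top hc_zero),
    ENNReal.le_div_iff_mul_le (.inl hc_zero) (.inl hc_top), ← tsum_indicator_inv_mul,
    ← ENNReal.tsum_mul_right]
  refine (ENNReal.tsum_le_tsum fun l ↦ ?_).trans (h.tsum_enorm_translate_sq_le x)
  by_cases hl : x⁻¹ * (l : G) ∈ O
  · rw [Set.indicator_of_mem hl, Pi.one_apply, one_mul, ← ofReal_norm]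
    exact pow_le_pow_left' (ENNReal.ofReal_le_ofReal hl.le) 2
  · rw [Set.indicator_of_notMem hl, zero_mul]
    exact zero_le

variable [T2Space G] {μ : Measure G} [μ.IsHaarMeasure] [μ.IsInvInvariant] {Q : Set G} {d : ℝ}
  {D : ℝ≥0}

theorem IsFrame.le_lowerDensity (h : π.IsFrame Λ g A B) (hg_ne : g ≠ 0) (hQ : Q ∈ 𝓝 1)
    (hg : g ∈ π.B2 μ Q) (hd : π.IsFormalDegree μ d) (hD : HasLowerDensity μ Λ D) :
    A ≤ d⁻¹ * D * ‖g‖ ^ 2 := by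
  have hψ_top : ∫⁻ x, localMaximal μ Q (π.coeff g g) x ^ 2 ∂μ ≠ ∞ := by
    have h_lt := lintegral_rpow_enorm_lt_top_of_eLpNorm_lt_top two_ne_zero ENNReal.ofNat_ne_top
      hg.memLp.2
    simpa using h_lt.ne
  have h_le := hD.le_mul_lintegral (h.isRelativelySeparated hg_ne) (interior_mem_nhds.2 hQ)
    ((π.stronglyMeasurable_coeff g g).enorm.pow_const 2)
    (hg.memLp.1.aemeasurable.pow_const 2) hψ_top
    (fun x z hz ↦ pow_le_pow_left'
      (enorm_mul_le_localMaximal (π.continuous_norm_coeff g g) x hz) 2)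
    h.le_tsum_enorm_translate_sq
  have hd_pos := hd.1
  rw [hd.lintegral_enorm_coeff_self_sq, ← ENNReal.ofReal_coe_nnreal,
    ← ENNReal.ofReal_mul D.coe_nonneg, ENNReal.ofReal_le_ofReal_iff (by positivity)] at h_le
  have hg_pos : 0 < ‖g‖ ^ 2 := by positivity
  exact le_of_mul_le_mul_right (h_le.trans_eq (by ring)) hg_pos

theorem IsFrame.upperDensity_le (h : π.IsFrame Λ g A B) (hg_ne : g ≠ 0)
    (hd : π.IsFormalDegree μ d) (hD : HasUpperDensity μ Λ D) :
    d⁻¹ * D * ‖g‖ ^ 2 ≤ B := by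
  have h_le := hD.mul_lintegral_le (h.isRelativelySeparated hg_ne)
    ((π.stronglyMeasurable_coeff g g).enorm.pow_const 2)
    (hd.lintegral_enorm_coeff_self_sq g ▸ ENNReal.ofReal_ne_top) h.tsum_enorm_translate_sq_le
  have hB := h.upper_pos
  rw [hd.lintegral_enorm_coeff_self_sq, ← ENNReal.ofReal_coe_nnreal,
    ← ENNReal.ofReal_mul D.coe_nonneg, ENNReal.ofReal_le_ofReal_iff (by positivity)] at h_le
  have hg_pos : 0 < ‖g‖ ^ 2 := by positivity
  exact le_of_mul_le_mul_right (h_le.trans_eq' (by ring)) hg_pos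

end Topological

end ProjRep

end Frame

end CoherentFrame

theorem corollary3p5
    {G : Type*} [Group G] [TopologicalSpace G] [IsTopologicalGroup G] [T2Space G]
    [LocallyCompactSpace G] [SecondCountableTopology G] [MeasurableSpace G] [BorelSpace G]
    (μ : Measure G) [μ.IsHaarMeasure] [μ.IsMulRightInvariant] (hG : IsAmenable μ)
    (Q : Set G) (hQ : IsCompact Q) (hQ_nhds : Q ∈ 𝓝 (1 : G)) (hQ_symm : Q⁻¹ = Q)
    {H : Type*} [NormedAddCommGroup H] [InnerProductSpace ℂ H] [CompleteSpace H]
    (π : ProjRep G H) (hπ : π.IsDiscreteSeries μ)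
    (Λ : Set G) (hΛ : IsDiscrete Λ) (g : H) (hg : g ∈ π.B2 μ Q)
    (A B : ℝ) (hframe : π.IsFrame Λ g A B) :
    ∃ (d : ℝ) (Dlow Dup : ℝ≥0),
      π.IsFormalDegree μ d ∧ HasLowerDensity μ Λ Dlow ∧ HasUpperDensity μ Λ Dup ∧
      A ≤ d⁻¹ * Dlow * ‖g‖ ^ 2 ∧
      d⁻¹ * Dlow * ‖g‖ ^ 2 ≤ d⁻¹ * Dup * ‖g‖ ^ 2 ∧
      d⁻¹ * Dup * ‖g‖ ^ 2 ≤ B ∧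
      (A = B → Dlow = Dup) := by
  have := isInvInvariant_of_isMulRightInvariant μ
  obtain ⟨e, he, -⟩ := hπ.2
  have : Nontrivial H := ⟨e, 0, he⟩
  have hg_ne : g ≠ 0 := hframe.ne_zero
  have h_sep : IsRelativelySeparated Λ := hframe.isRelativelySeparated hg_ne
  obtain ⟨K, hK⟩ := hG
  have h_strong : ∃ L : ℕ → Set G, IsStrongFolner μ L := ⟨_, hK.isStrongFolner_mul hQ hQ_nhds⟩
  obtain ⟨d, hd⟩ := hπ.exists_isFormalDegree
  obtain ⟨Dlow, hlow⟩ := h_sep.exists_hasLowerDensity h_strong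
  obtain ⟨Dup, hup⟩ := h_sep.exists_hasUpperDensity h_strong
  have hA : A ≤ d⁻¹ * Dlow * ‖g‖ ^ 2 := hframe.le_lowerDensity hg_ne hQ_nhds hg hd hlow
  have hB : d⁻¹ * Dup * ‖g‖ ^ 2 ≤ B := hframe.upperDensity_le hg_ne hd hup
  have h_le : Dlow ≤ Dup := hlow.le_of_hasUpperDensity hup
  have hd_pos : 0 < d⁻¹ := inv_pos.2 hd.1
  refine ⟨d, Dlow, Dup, hd, hlow, hup, hA, by gcongr, hB, fun hAB ↦ h_le.antisymm ?_⟩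
  have h_collapse : d⁻¹ * Dup * ‖g‖ ^ 2 ≤ d⁻¹ * Dlow * ‖g‖ ^ 2 := hB.trans (hAB ▸ hA)
  have hg_pos : 0 < ‖g‖ ^ 2 := by positivity
  exact_mod_cast le_of_mul_le_mul_left (le_of_mul_le_mul_right h_collapse hg_pos) hd_pos
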